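/- Let $\mathrm{ZFC}^-$ be the theory with the axioms of extensionality, foundation, pairing, union and infinity, the separation and collection schemes (for all first-order formulas with parameters), and the axiom that every set can be well-ordered (no power set axiom). Let $\hat V=(\hat V,\hat\in)$ be a model of $\mathrm{ZFC}^-$ that is $\omega$-nonstandard, i.e. some element of $\hat\omega=(\omega)^{\hat V}$ has infinitely many predecessors; let $\hat<$ be the order $\hat\in$ on $\hat\omega$. For a linear order $(L,<)$ and infinite regular cardinals $\kappa,\theta$, a $(\kappa,\theta)$-cut in $L$ is a pair of sequences $(a_\alpha:\alpha<\kappa)$, $(b_\beta:\beta<\theta)$ in $L$ such that $a_\alpha<a_{\alpha'}<b_{\beta'}<b_\beta$ for all $\alpha<\alpha'<\kappa$ and $\beta<\beta'<\theta$, and there is no $c\in L$ with $a_\alpha<c<b_\beta$ for all $\alpha,\beta$. Let $\mathcal C_{\hat V}$ be the set of all pairs $(\kappa,\theta)$ of infinite regular cardinals such that $(\hat\omega,\hat<)$ has a $(\kappa,\theta)$-cut, and let $$\mathfrak p_{\hat V}=\min\{\kappa+\theta:(\kappa,\theta)\in\mathcal C_{\hat V}\}.$$ For $\hat n\in\hat\omega$,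 let $\hat n^{<\hat n}$ be the set, in the sense of $\hat V$, of all functions from some $\hat m\mathrel{\hat<}\hat n$ to $\hat n$, partially ordered by inclusion. For a tree $T$ let $\text{tree-tops}(T)$ be the least cardinal $\kappa$ such that $T$ has an increasing sequence $(s_\alpha:\alpha<\kappa)$ with no upper bound in $T$ (undefined if there is no such sequence), and let $\mathfrak t_{\hat V}$ be the least value of $\text{tree-tops}(\hat n^{<\hat n})$ over all nonzero $\hat n\in\hat\omega$ for which it is defined. Then $\mathfrak t_{\hat V}$ is defined and $\mathfrak p_{\hat V}\le\mathfrak t_{\hat V}$. In fact $(\mathfrak t_{\hat V},\mathfrak t_{\hat V})\in\mathcal C_{\hat V}$. -/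

import Mathlib

open FirstOrder Cardinal

universe u

namespace ZFCMinus

/-- The relation symbols of the language of set theory: a single binary symbol. -/
inductive SetRel : ℕ → Type
  | mem : SetRel 2

/-- The first-order language of set theory. -/
def setLang : Language := ⟨fun _ => Empty, SetRel⟩

section Model

variable {V : Type u} [setLang.Structure V]

/-- The membership relation of the structure `V`. -/
def In (x y : V) : Prop :=
  Language.Structure.RelMap (L := setLang) (M := V) SetRel.mem ![x, y]

local infix:50 " ε " => In

/-- `V ⊨ z = ∅`. -/
def IsEmptySet (z : V) : Prop := ∀ w : V, ¬ w ε z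

/-- `V ⊨ z = {x, y}`. -/
def IsUPair (z x y : V) : Prop := ∀ w : V, w ε z ↔ w = x ∨ w = y

/-- `V ⊨ p = (x, y)`, where `(x, y) = {{x}, {x, y}}`. -/
def IsOPair (p x y : V) : Prop := ∀ z : V, z ε p ↔ IsUPair z x x ∨ IsUPair z x y

/-- `V ⊨ y = x ∪ {x}`. -/
def IsSucc (y x : V) : Prop := ∀ w : V, w ε y ↔ w ε x ∨ w = x

/-- `V ⊨` "`I` contains `∅` and is closed under `x ↦ x ∪ {x}`". -/
def IsInductive (I : V) : Prop :=
  (∃ z : V, IsEmptySet z ∧ z ε I) ∧ ∀ x : V, x ε I → ∃ y : V, IsSucc y x ∧ y ε I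

/-- `V ⊨ (x, y) ∈ r`. -/
def PairIn (r x y : V) : Prop := ∃ p : V, IsOPair p x y ∧ p ε r

/-- `V ⊨` "`r` (a set of ordered pairs) is a strict well-ordering of the set `a`". -/
def WellOrders (r a : V) : Prop :=
  (∀ x : V, x ε a → ¬ PairIn r x x) ∧
  (∀ x y z : V, x ε a → y ε a → z ε a → PairIn r x y → PairIn r y z → PairIn r x z) ∧
  (∀ x y : V, x ε a → y ε a → x = y ∨ PairIn r x y ∨ PairIn r y x) ∧
  (∀ b : V, (∀ x : V, x ε b → x ε a) → (∃ x : V, x ε b) →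
    ∃ m : V, m ε b ∧ ∀ x : V, x ε b → x = m ∨ PairIn r m x)

/-- `V ⊨` "`f` is a function from `a` to `b`". -/
def IsFunc (f a b : V) : Prop :=
  (∀ p : V, p ε f → ∃ x y : V, x ε a ∧ y ε b ∧ IsOPair p x y) ∧
  (∀ x : V, x ε a → ∃! y : V, PairIn f x y)

variable (V) in
/-- `V ⊨ ZFC⁻`: set theory without the power set axiom, with the collection scheme and with the
well-ordering principle. The two schemes range over all first-order formulas of the language of
set theory with parameters from `V`, that is, over all parametrically definable classes and
binary relations. -/
structure ModelsZFCMinus : Prop where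
  extensionality : ∀ x y : V, (∀ z : V, z ε x ↔ z ε y) → x = y
  foundation : ∀ x : V, (∃ y : V, y ε x) → ∃ y : V, y ε x ∧ ∀ z : V, z ε x → ¬ z ε y
  pairing : ∀ x y : V, ∃ z : V, IsUPair z x y
  union : ∀ x : V, ∃ u : V, ∀ z : V, z ε u ↔ ∃ y : V, y ε x ∧ z ε y
  infinity : ∃ I : V, IsInductive I
  separation : ∀ X : Set V, (Set.univ : Set V).Definable₁ setLang X →
    ∀ a : V, ∃ b : V, ∀ x : V, x ε b ↔ x ε a ∧ x ∈ X
  collection : ∀ R : Set (V × V), (Set.univ : Set V).Definable₂ setLang R →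
    ∀ a : V, (∀ x : V, x ε a → ∃ y : V, (x, y) ∈ R) →
      ∃ b : V, ∀ x : V, x ε a → ∃ y : V, y ε b ∧ (x, y) ∈ R
  wellOrdering : ∀ a : V, ∃ r : V, WellOrders r a

/-- `V ⊨ n ∈ ω`: the element `n` lies in every inductive set of `V`. -/
def IsNatural (n : V) : Prop := ∀ I : V, IsInductive I → n ε I

variable (V) in
/-- The natural numbers of `V`. -/
def Omega : Type u := {n : V // IsNatural n}

/-- The order of the natural numbers of `V` is the membership relation. -/
instance : LT (Omega V) := ⟨fun m n => m.1 ε n.1⟩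

variable (V) in
/-- `V` is `ω`-nonstandard: some natural number of `V` has infinitely many predecessors. -/
def OmegaNonstandard : Prop := ∃ n : Omega V, {m : Omega V | m < n}.Infinite

/-- The elements `s` of `V` with `V ⊨ s ∈ n^{<n}`: the functions from some `m < n` to `n`. -/
def SeqTree (n : Omega V) : Type u := {s : V // ∃ m : V, m ε n.1 ∧ IsFunc s m n.1}

/-- The set `n^{<n}` of `V` is ordered by inclusion; the strict order is proper inclusion. -/
instance (n : Omega V) : Preorder (SeqTree n) where
  le s t := ∀ z : V, z ε s.1 → z ε t.1
  le_refl _ _ h := h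
  le_trans _ _ _ h₁ h₂ z hz := h₂ z (h₁ z hz)

end Model

section Cuts

variable (L : Type u) [LT L]

/-- `(a, b)` is a `(κ, θ)`-pre-cut in `L`. -/
def IsPreCut {κ θ : Cardinal.{u}} (a : κ.ord.ToType → L) (b : θ.ord.ToType → L) : Prop :=
  ∀ α α' : κ.ord.ToType, ∀ β β' : θ.ord.ToType, α < α' → β < β' →
    a α < a α' ∧ a α' < b β' ∧ b β' < b β

/-- `(a, b)` is a `(κ, θ)`-cut in `L`: a pre-cut which no element of `L` fills. -/
def IsCut {κ θ : Cardinal.{u}} (a : κ.ord.ToType → L) (b : θ.ord.ToType → L) : Prop :=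
  IsPreCut L a b ∧ ¬ ∃ c : L, ∀ (α : κ.ord.ToType) (β : θ.ord.ToType), a α < c ∧ c < b β

/-- The cut spectrum of `L`: the pairs `(κ, θ)` of infinite regular cardinals such that `L` has a
`(κ, θ)`-cut. -/
def cutSpectrum : Set (Cardinal.{u} × Cardinal.{u}) :=
  {q | q.1.IsRegular ∧ q.2.IsRegular ∧
    ∃ (a : q.1.ord.ToType → L) (b : q.2.ord.ToType → L), IsCut L a b}

/-- `cut(L)`, the least `κ + θ` with `(κ, θ)` in the cut spectrum of `L`. -/
noncomputable def cutNumber : Cardinal.{u} :=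
  sInf {c | ∃ κ θ : Cardinal.{u}, (κ, θ) ∈ cutSpectrum L ∧ c = κ + θ}

end Cuts

/-- The cardinals `κ` such that `T` has an increasing `κ`-sequence without an upper bound. -/
def unboundedLengths (T : Type u) [Preorder T] : Set Cardinal.{u} :=
  {κ | ∃ s : κ.ord.ToType → T, StrictMono s ∧ ¬ BddAbove (Set.range s)}

/-- `κ = tree-tops(T)`: `κ` is the least length of an increasing sequence in `T` without an
upper bound. A tree may have no such sequence, and then it has no tree-tops number. -/
def IsTreeTops (T : Type u) [Preorder T] (κ : Cardinal.{u}) : Prop :=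
  IsLeast (unboundedLengths T) κ

section Invariants

variable (V : Type u) [setLang.Structure V]

/-- The cut spectrum of the natural numbers of `V`. -/
def cutSpectrumOmega : Set (Cardinal.{u} × Cardinal.{u}) := cutSpectrum (Omega V)

/-- The invariant `𝔭` of `V`. -/
noncomputable def pNumber : Cardinal.{u} := cutNumber (Omega V)

/-- The invariant `𝔱` of `V`: the least tree-tops number of a tree `n^{<n}` of `V`, where `n` is a
natural number of `V`. For `n = 0` the set `n^{<n}` is empty, hence not a tree; so `n` is taken
to be nonzero. -/
noncomputable def tNumber : Cardinal.{u} :=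
  sInf {κ | ∃ n : Omega V, (∃ m : Omega V, m < n) ∧ IsTreeTops (SeqTree n) κ}

end Invariants

end ZFCMinus

/-! Two facts carry the proof.

An unbounded increasing sequence `s_α` in a tree gives a symmetric cut
(`mem_cutSpectrumOmega_of_isTreeTops`). Shift the values of `s_α` by one and append either `0` or
`n+1`. In the lexicographic order of functions from `n` to `n+2` this gives an increasing and a
decreasing sequence, and a function between them would extend every `s_α`. This order is finite
inside `V`, so it embeds into the natural numbers of `V`, and a number filling the gap rounds down
to a function. A tree-tops number is regular because it is least. So if `𝔱` is defined, then `(𝔱,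
𝔱)` is in the cut spectrum and `𝔭 ≤ 𝔱 + 𝔱 = 𝔱`.

`𝔱` is defined (`OmegaNonstandard.not_treesBounded`). Suppose that all increasing sequences in all
trees are bounded. The standard numbers leave a gap, so there is a least `ν` for which some gap with
sides of size at most `ν` is unfilled. Passing to cofinal sequences gives a cut with regular sides,
the longer one of length `ν`. Bounded trees allow transfinite recursion along `a_μ`: a bound of the
earlier stages is cut off at the first failure of a definable property, which by overspill lies
above all earlier `a_α`.

For equal sides, build a nonincreasing `r` with `r(a_μ) = b_μ`; the place where its graph meets the
diagonal fills the cut. For a lower side of length `ν` and an upper one of length `κ < ν`, first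
obtain a compactness principle (`TreesBounded.exists_mem_forall`). Then build functions `r(x)` such
that more than `κ` of the points `a_β` stay in the support and `r(a_β')(a_β)` is a member of the
upper side chosen injectively in `β < β'`. Overspilling past a single `b_δ` forces fewer than `κ`
predecessors on each member of a set of size above `κ`, which is absurd. A longer upper side is
handled by reversing the order below a bound. -/

namespace ZFCMinus

/-! ### Definability with parameters -/

section Definability

variable {V : Type u} [setLang.Structure V]

/-- The predicate `P` on tuples of elements of `V` is definable with parameters. -/
class DefinablePred {α : Type} (P : (α → V) → Prop) : Prop where
  out : (Set.univ : Set V).Definable setLang {v | P v}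

/-- The function `t` on tuples of elements of `V` is definable with parameters. -/
class DefinableFn {α : Type} (t : (α → V) → V) : Prop where
  out : (Set.univ : Set V).DefinableFun setLang t

variable {α β : Type} {P Q : (α → V) → Prop} {t t' : (α → V) → V}

theorem DefinablePred.comp [Finite β] {R : (β → V) → Prop} (hR : DefinablePred R)
    {F : (α → V) → β → V} (hF : ∀ i, DefinableFn (fun v => F v i)) :
    DefinablePred (fun v => R (F v)) :=
  ⟨Set.Definable.preimage_map (F := F) (fun i => (hF i).out) hR.out⟩

theorem DefinablePred.comp₁ {R : V → Prop} (hR : DefinablePred (fun v : Fin 1 → V => R (v 0)))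
    {t : (α → V) → V} [ht : DefinableFn t] : DefinablePred (fun v => R (t v)) :=
  hR.comp (F := fun v => ![t v]) (by intro i; fin_cases i; exact ht)

theorem DefinablePred.comp₂ {R : V → V → Prop}
    (hR : DefinablePred (fun v : Fin 2 → V => R (v 0) (v 1)))
    {t u : (α → V) → V} [ht : DefinableFn t] [hu : DefinableFn u] :
    DefinablePred (fun v => R (t v) (u v)) :=
  hR.comp (F := fun v => ![t v, u v]) (by intro i; fin_cases i; exacts [ht, hu])

theorem DefinablePred.comp₃ {R : V → V → V → Prop}
    (hR : DefinablePred (fun v : Fin 3 → V => R (v 0) (v 1) (v 2)))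
    {t u w : (α → V) → V} [ht : DefinableFn t] [hu : DefinableFn u] [hw : DefinableFn w] :
    DefinablePred (fun v => R (t v) (u v) (w v)) :=
  hR.comp (F := fun v => ![t v, u v, w v]) (by intro i; fin_cases i; exacts [ht, hu, hw])

theorem DefinableFn.comp [Finite β] {G : (β → V) → V} (hG : DefinableFn G)
    {F : (α → V) → β → V} (hF : ∀ i, DefinableFn (fun v => F v i)) :
    DefinableFn (fun v => G (F v)) :=
  ⟨Set.DefinableFun.comp (g := F) (fun i => (hF i).out) hG.out⟩

theorem DefinableFn.comp₁ {G : V → V} (hG : DefinableFn (fun v : Fin 1 → V => G (v 0)))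
    {t : (α → V) → V} [ht : DefinableFn t] : DefinableFn (fun v => G (t v)) :=
  hG.comp (F := fun v => ![t v]) (by intro i; fin_cases i; exact ht)

theorem DefinableFn.comp₂ {G : V → V → V} (hG : DefinableFn (fun v : Fin 2 → V => G (v 0) (v 1)))
    {t u : (α → V) → V} [ht : DefinableFn t] [hu : DefinableFn u] :
    DefinableFn (fun v => G (t v) (u v)) :=
  hG.comp (F := fun v => ![t v, u v]) (by intro i; fin_cases i; exacts [ht, hu])

instance DefinableFn.proj (i : α) : DefinableFn (fun v : α → V => v i) :=
  ⟨Set.DefinableFun.proj setLang⟩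

instance DefinableFn.const (c : V) : DefinableFn (fun _ : α → V => c) :=
  ⟨setLang.definableFun_const α (Set.mem_univ c)⟩

instance DefinableFn.ite [DecidablePred P] [hP : DefinablePred P] [ht : DefinableFn t]
    [ht' : DefinableFn t'] : DefinableFn (fun v => if P v then t v else t' v) :=
  ⟨Set.DefinableFun.ite hP.out ht.out ht'.out⟩

theorem definablePred_in : DefinablePred (fun v : Fin 2 → V => In (v 0) (v 1)) := by
  let φ : setLang.Formula (Fin 2) := Language.Relations.formula
    (SetRel.mem : setLang.Relations 2) ![Language.Term.var 0, Language.Term.var 1]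
  refine ⟨(Set.empty_definable_iff.2 ⟨φ, ?_⟩).mono (Set.empty_subset _)⟩
  ext v
  refine Iff.trans ?_ (Language.Formula.realize_rel (L := setLang)).symm
  apply iff_of_eq
  refine congrArg (Language.Structure.RelMap (L := setLang) (M := V) SetRel.mem) ?_
  ext i
  fin_cases i <;> rfl

instance DefinablePred.in [DefinableFn t] [DefinableFn t'] :
    DefinablePred (fun v => In (t v) (t' v)) :=
  definablePred_in.comp₂

instance DefinablePred.eq [ht : DefinableFn t] [ht' : DefinableFn t'] :
    DefinablePred (fun v => t v = t' v) :=
  ⟨ht.out.ofPred_eq ht'.out⟩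

instance DefinablePred.and [hP : DefinablePred P] [hQ : DefinablePred Q] :
    DefinablePred (fun v => P v ∧ Q v) :=
  ⟨hP.out.inter hQ.out⟩

instance DefinablePred.or [hP : DefinablePred P] [hQ : DefinablePred Q] :
    DefinablePred (fun v => P v ∨ Q v) :=
  ⟨hP.out.union hQ.out⟩

instance DefinablePred.not [hP : DefinablePred P] : DefinablePred (fun v => ¬ P v) :=
  ⟨hP.out.compl⟩

instance DefinablePred.imp [hP : DefinablePred P] [hQ : DefinablePred Q] :
    DefinablePred (fun v => P v → Q v) := by
  simp only [imp_iff_not_or]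
  infer_instance

instance DefinablePred.iff [hP : DefinablePred P] [hQ : DefinablePred Q] :
    DefinablePred (fun v => P v ↔ Q v) := by
  simp only [iff_iff_implies_and_implies]
  infer_instance

instance DefinablePred.constant (p : Prop) : DefinablePred (fun _ : α → V => p) := by
  by_cases h : p
  · simp only [h]
    exact ⟨Set.definable_univ⟩
  · simp only [h]
    exact ⟨Set.definable_empty⟩

/-- The bound variable is the extra coordinate `none`, so quantification is projection along `some`.
With this form instance search proves definability of a formula by following its syntax. -/
instance DefinablePred.exists [Finite α] {R : (α → V) → V → Prop}
    [hR : DefinablePred (fun w : Option α → V => R (fun i => w (some i)) (w none))] :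
    DefinablePred (fun v => ∃ x, R v x) := by
  refine ⟨?_⟩
  convert hR.out.image_comp (some : α → Option α) using 1
  ext v
  constructor
  · rintro ⟨x, hx⟩
    exact ⟨fun i => i.elim x v, hx, rfl⟩
  · rintro ⟨w, hw, rfl⟩
    exact ⟨w none, hw⟩

instance DefinablePred.forall [Finite α] {R : (α → V) → V → Prop}
    [hR : DefinablePred (fun w : Option α → V => R (fun i => w (some i)) (w none))] :
    DefinablePred (fun v => ∀ x, R v x) := by
  have : DefinablePred (fun v => ¬ ∃ x, ¬ R v x) := inferInstance
  simpa only [not_exists, not_not] using this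

instance DefinablePred.existsUnique [Finite α] {R : (α → V) → V → Prop}
    [hR : DefinablePred (fun w : Option α → V => R (fun i => w (some i)) (w none))] :
    DefinablePred (fun v => ∃! x, R v x) := by
  unfold ExistsUnique
  have : DefinablePred (fun w : Option (Option α) → V =>
      R (fun i => w (some (some i))) (w none)) :=
    hR.comp (F := fun w i => i.elim (w none) (fun j => w (some (some j))))
      (by rintro (_ | i) <;> exact DefinableFn.proj _)
  infer_instance

theorem DefinableFn.of_graph [Finite α]
    (h : DefinablePred (fun w : Option α → V => w none = t (fun i => w (some i)))) :
    DefinableFn t := by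
  refine ⟨?_⟩
  unfold Set.DefinableFun
  convert h.out using 1
  ext w
  exact eq_comm

theorem definablePred_isEmptySet : DefinablePred (fun v : Fin 1 → V => IsEmptySet (v 0)) := by
  unfold IsEmptySet; infer_instance

instance [DefinableFn t] : DefinablePred (fun v => IsEmptySet (t v)) :=
  definablePred_isEmptySet.comp₁

theorem definablePred_isUPair :
    DefinablePred (fun v : Fin 3 → V => IsUPair (v 0) (v 1) (v 2)) := by
  unfold IsUPair; infer_instance

variable {t'' : (α → V) → V}

instance [DefinableFn t] [DefinableFn t'] [DefinableFn t''] :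
    DefinablePred (fun v => IsUPair (t v) (t' v) (t'' v)) :=
  definablePred_isUPair.comp₃

theorem definablePred_isOPair :
    DefinablePred (fun v : Fin 3 → V => IsOPair (v 0) (v 1) (v 2)) := by
  unfold IsOPair; infer_instance

instance [DefinableFn t] [DefinableFn t'] [DefinableFn t''] :
    DefinablePred (fun v => IsOPair (t v) (t' v) (t'' v)) :=
  definablePred_isOPair.comp₃

theorem definablePred_isSucc :
    DefinablePred (fun v : Fin 2 → V => IsSucc (v 0) (v 1)) := by
  unfold IsSucc; infer_instance

instance [DefinableFn t] [DefinableFn t'] : DefinablePred (fun v => IsSucc (t v) (t' v)) :=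
  definablePred_isSucc.comp₂

theorem definablePred_isInductive :
    DefinablePred (fun v : Fin 1 → V => IsInductive (v 0)) := by
  unfold IsInductive; infer_instance

instance [DefinableFn t] : DefinablePred (fun v => IsInductive (t v)) :=
  definablePred_isInductive.comp₁

theorem definablePred_isNatural :
    DefinablePred (fun v : Fin 1 → V => IsNatural (v 0)) := by
  unfold IsNatural; infer_instance

instance [DefinableFn t] : DefinablePred (fun v => IsNatural (t v)) :=
  definablePred_isNatural.comp₁

theorem definablePred_pairIn :
    DefinablePred (fun v : Fin 3 → V => PairIn (v 0) (v 1) (v 2)) := by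
  unfold PairIn; infer_instance

instance [DefinableFn t] [DefinableFn t'] [DefinableFn t''] :
    DefinablePred (fun v => PairIn (t v) (t' v) (t'' v)) :=
  definablePred_pairIn.comp₃

theorem definablePred_isFunc :
    DefinablePred (fun v : Fin 3 → V => IsFunc (v 0) (v 1) (v 2)) := by
  unfold IsFunc; infer_instance

instance [DefinableFn t] [DefinableFn t'] [DefinableFn t''] :
    DefinablePred (fun v => IsFunc (t v) (t' v) (t'' v)) :=
  definablePred_isFunc.comp₃

end Definability

end ZFCMinus

namespace ZFCMinus

/-! ### Elementary set theory inside a model -/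

infix:50 " ∊ " => In

section SetTheory

variable {V : Type u} [setLang.Structure V]

theorem Omega.lt_def {m n : Omega V} : m < n ↔ m.1 ∊ n.1 := Iff.rfl

variable [hV : Fact (ModelsZFCMinus V)]

theorem In.ext {x y : V} (h : ∀ z : V, z ∊ x ↔ z ∊ y) : x = y :=
  hV.out.extensionality x y h

theorem exists_sep (a : V) (P : V → Prop) [hP : DefinablePred (fun v : Fin 1 → V => P (v 0))] :
    ∃ b : V, ∀ x, x ∊ b ↔ x ∊ a ∧ P x :=
  hV.out.separation {x | P x} hP.out a

/-- The union of a definable family of sets indexed by a set is a set. -/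
theorem exists_biUnion (a : V) (R : V → V → Prop)
    [hR : DefinablePred (fun v : Fin 2 → V => R (v 0) (v 1))]
    (h : ∀ x, x ∊ a → ∃ u : V, ∀ z, z ∊ u ↔ R x z) :
    ∃ b : V, ∀ z, z ∊ b ↔ ∃ x, x ∊ a ∧ R x z := by
  have key : ∀ {α : Type} [Finite α] (t t' : (α → V) → V) [DefinableFn t] [DefinableFn t'],
      DefinablePred (fun v => R (t v) (t' v)) := fun t t' _ _ => hR.comp₂
  have d1 : DefinablePred (fun v : Fin 2 → V => ∀ z, z ∊ v 1 ↔ R (v 0) z) := by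
    have := key (fun w : Option (Fin 2) → V => w (some 0)) (fun w => w none)
    infer_instance
  obtain ⟨b, hb⟩ := hV.out.collection {p | ∀ z, z ∊ p.2 ↔ R p.1 z} d1.out a h
  obtain ⟨U, hU⟩ := hV.out.union b
  have d2 : DefinablePred (fun v : Fin 1 → V => ∃ x, x ∊ a ∧ R x (v 0)) := by
    have := key (fun w : Option (Fin 1) → V => w none) (fun w => w (some 0))
    infer_instance
  -- Collection may return superfluous sets besides the sections of `R`; separation removes their
  -- elements.
  obtain ⟨c, hc⟩ := exists_sep U (fun z => ∃ x, x ∊ a ∧ R x z)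
  refine ⟨c, fun z => ⟨fun hz => ((hc z).1 hz).2, fun hz => (hc z).2 ⟨?_, hz⟩⟩⟩
  obtain ⟨x, hx, hxz⟩ := hz
  obtain ⟨y, hy, hxy⟩ := hb x hx
  exact (hU z).2 ⟨y, hy, (hxy z).2 hxz⟩

theorem exists_image (a : V) (G : V → V) [hG : DefinableFn (fun v : Fin 1 → V => G (v 0))] :
    ∃ b : V, ∀ z, z ∊ b ↔ ∃ x, x ∊ a ∧ z = G x := by
  have : DefinableFn (fun v : Fin 2 → V => G (v 0)) := hG.comp₁
  refine exists_biUnion a (fun x z => z = G x) fun x _ => ?_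
  obtain ⟨u, hu⟩ := hV.out.pairing (G x) (G x)
  exact ⟨u, fun z => by simpa using hu z⟩

variable (V) in
theorem exists_empty : ∃ x : V, IsEmptySet x := by
  obtain ⟨I, ⟨z, hz, -⟩, -⟩ := hV.out.infinity
  exact ⟨z, hz⟩

variable (V) in
/-- The empty set of `V`. -/
noncomputable def zero : V := (exists_empty V).choose

theorem notMem_zero (x : V) : ¬ x ∊ zero V := (exists_empty V).choose_spec x

theorem isEmptySet_iff {x : V} : IsEmptySet x ↔ x = zero V :=
  ⟨fun h => In.ext fun z => iff_of_false (h z) (notMem_zero z), fun h => h ▸ notMem_zero⟩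

theorem exists_adjoin (x a : V) : ∃ y : V, ∀ z, z ∊ y ↔ z ∊ x ∨ z = a := by
  obtain ⟨s, hs⟩ := hV.out.pairing a a
  obtain ⟨p, hp⟩ := hV.out.pairing x s
  obtain ⟨u, hu⟩ := hV.out.union p
  refine ⟨u, fun z => (hu z).trans ⟨?_, ?_⟩⟩
  · rintro ⟨y, hy, hz⟩
    rcases (hp y).1 hy with rfl | rfl
    · exact .inl hz
    · exact .inr (by simpa using (hs z).1 hz)
  · rintro (h | rfl)
    · exact ⟨x, (hp x).2 (.inl rfl), h⟩
    · exact ⟨s, (hp s).2 (.inr rfl), (hs z).2 (.inl rfl)⟩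

/-- The set `x ∪ {a}`. -/
noncomputable def adjoin (x a : V) : V := (exists_adjoin x a).choose

@[simp] theorem mem_adjoin {x a z : V} : z ∊ adjoin x a ↔ z ∊ x ∨ z = a :=
  (exists_adjoin x a).choose_spec z

theorem definableFn_adjoin : DefinableFn (fun v : Fin 2 → V => adjoin (v 0) (v 1)) := by
  refine .of_graph ?_
  have : ∀ y x a : V, y = adjoin x a ↔ ∀ z, z ∊ y ↔ z ∊ x ∨ z = a := fun y x a =>
    ⟨fun h z => h ▸ mem_adjoin, fun h => In.ext fun z => (h z).trans mem_adjoin.symm⟩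
  simp only [this]
  infer_instance

theorem isSucc_iff {x y : V} : IsSucc y x ↔ y = adjoin x x :=
  ⟨fun h => In.ext fun z => (h z).trans mem_adjoin.symm, fun h _ => h ▸ mem_adjoin⟩

/-- The ordered pair `(x, y)`. -/
noncomputable def opair (x y : V) : V :=
  adjoin (adjoin (zero V) (adjoin (zero V) x)) (adjoin (adjoin (zero V) x) y)

theorem isUPair_iff {z x y : V} : IsUPair z x y ↔ z = adjoin (adjoin (zero V) x) y := by
  constructor
  · intro h
    exact In.ext fun w => by simp [h w, notMem_zero]
  · rintro rfl w
    simp [notMem_zero]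

theorem isOPair_iff {p x y : V} : IsOPair p x y ↔ p = opair x y := by
  have h1 : adjoin (adjoin (zero V) x) x = adjoin (zero V) x := In.ext fun w => by simp
  constructor
  · intro h
    exact In.ext fun w => by simp [h w, isUPair_iff, opair, h1, notMem_zero]
  · rintro rfl w
    simp [isUPair_iff, opair, h1, notMem_zero]

theorem opair_inj {x y x' y' : V} : opair x y = opair x' y' ↔ x = x' ∧ y = y' := by
  refine ⟨fun h => ?_, by rintro ⟨rfl, rfl⟩; rfl⟩
  have h1 : ∀ z : V, (z = adjoin (zero V) x ∨ z = adjoin (adjoin (zero V) x) y) ↔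
      (z = adjoin (zero V) x' ∨ z = adjoin (adjoin (zero V) x') y') := by
    intro z
    have : z ∊ opair x y ↔ z ∊ opair x' y' := by rw [h]
    simpa [opair, notMem_zero] using this
  have s : ∀ {a b : V}, a = b → ∀ w, w ∊ a ↔ w ∊ b := by rintro a _ rfl w; rfl
  have hx : x = x' := by
    rcases (h1 _).1 (.inl rfl) with e | e
    · simpa [notMem_zero] using (s e x).1 (by simp)
    · have := (s e x').2 (by simp)
      simpa [notMem_zero, eq_comm] using this
  subst hx
  refine ⟨rfl, ?_⟩
  have hy : y = x ∨ y = y' := by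
    rcases (h1 _).1 (.inr rfl) with e | e
    · exact .inl (by simpa [notMem_zero] using (s e y).1 (by simp))
    · simpa [notMem_zero] using (s e y).1 (by simp)
  have hy' : y' = x ∨ y' = y := by
    rcases (h1 _).2 (.inr rfl) with e | e
    · exact .inl (by simpa [notMem_zero] using (s e y').1 (by simp))
    · simpa [notMem_zero] using (s e y').1 (by simp)
  grind

variable {α : Type} {t t' : (α → V) → V}

instance [DefinableFn t] [DefinableFn t'] : DefinableFn (fun v => adjoin (t v) (t' v)) :=
  definableFn_adjoin.comp₂

instance [DefinableFn t] [DefinableFn t'] : DefinableFn (fun v => opair (t v) (t' v)) := by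
  unfold opair
  infer_instance

theorem pairIn_iff {r x y : V} : PairIn r x y ↔ opair x y ∊ r := by
  simp [PairIn, isOPair_iff]

theorem notMem_self (x : V) : ¬ x ∊ x := by
  intro h
  obtain ⟨y, hy, hy'⟩ := hV.out.foundation (adjoin (zero V) x) ⟨x, by simp⟩
  obtain rfl : y = x := by simpa [notMem_zero] using hy
  exact hy' y hy h

/-! ### Functions inside a model -/

open Classical in
/-- The value of the function `f` at `x`. -/
noncomputable def app (f x : V) : V :=
  if h : ∃! y, PairIn f x y then h.choose else zero V

theorem definableFn_app : DefinableFn (fun v : Fin 2 → V => app (v 0) (v 1)) := by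
  refine .of_graph ?_
  have : ∀ y f x : V, y = app f x ↔
      ((∃! y, PairIn f x y) ∧ PairIn f x y) ∨ (¬ (∃! y, PairIn f x y) ∧ y = zero V) := by
    intro y f x
    unfold app
    by_cases h : ∃! y, PairIn f x y
    · simp only [h, dif_pos, true_and, not_true, false_and, or_false]
      exact ⟨fun e => e ▸ h.choose_spec.1, fun e => h.unique e h.choose_spec.1⟩
    · simp [h]
  simp only [this]
  infer_instance

instance [DefinableFn t] [DefinableFn t'] : DefinableFn (fun v => app (t v) (t' v)) :=
  definableFn_app.comp₂

theorem IsFunc.pair_mem_iff {f a b x y : V} (hf : IsFunc f a b) :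
    opair x y ∊ f ↔ x ∊ a ∧ app f x = y := by
  have key : x ∊ a → opair x (app f x) ∊ f := by
    intro hx
    have h := hf.2 x hx
    rw [app, dif_pos h, ← pairIn_iff]
    exact h.choose_spec.1
  constructor
  · intro h
    obtain ⟨x', y', hx', -, e⟩ := hf.1 _ h
    rw [isOPair_iff, opair_inj] at e
    obtain ⟨rfl, rfl⟩ := e
    exact ⟨hx', (hf.2 x hx').unique (pairIn_iff.2 (key hx')) (pairIn_iff.2 h)⟩
  · rintro ⟨hx, rfl⟩
    exact key hx

theorem IsFunc.app_mem {f a b x : V} (hf : IsFunc f a b) (hx : x ∊ a) : app f x ∊ b := by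
  obtain ⟨x', y', -, hy', e⟩ := hf.1 _ (hf.pair_mem_iff.2 ⟨hx, rfl⟩)
  rw [isOPair_iff, opair_inj] at e
  exact e.2 ▸ hy'

theorem IsFunc.mem_iff {f a b p : V} (hf : IsFunc f a b) :
    p ∊ f ↔ ∃ x, x ∊ a ∧ p = opair x (app f x) := by
  constructor
  · intro h
    obtain ⟨x, y, hx, -, e⟩ := hf.1 _ h
    rw [isOPair_iff] at e
    subst e
    exact ⟨x, hx, by rw [(hf.pair_mem_iff.1 h).2]⟩
  · rintro ⟨x, hx, rfl⟩
    exact hf.pair_mem_iff.2 ⟨hx, rfl⟩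

theorem exists_func (a b : V) (G : V → V) [hG : DefinableFn (fun v : Fin 1 → V => G (v 0))]
    (h : ∀ x, x ∊ a → G x ∊ b) : ∃ f : V, IsFunc f a b ∧ ∀ x, x ∊ a → app f x = G x := by
  obtain ⟨f, hf⟩ := exists_image a (fun x => opair x (G x))
  have hf' : ∀ x y, opair x y ∊ f ↔ x ∊ a ∧ y = G x := fun x y => by
    rw [hf]
    constructor
    · rintro ⟨x', hx', e⟩
      rw [opair_inj] at e
      exact ⟨e.1 ▸ hx', e.1 ▸ e.2⟩
    · rintro ⟨hx, rfl⟩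
      exact ⟨x, hx, rfl⟩
  have hfunc : IsFunc f a b := by
    refine ⟨fun p hp => ?_, fun x hx => ?_⟩
    · obtain ⟨x, hx, rfl⟩ := (hf p).1 hp
      exact ⟨x, G x, hx, h x hx, isOPair_iff.2 rfl⟩
    · simp only [pairIn_iff, hf', hx, true_and]
      exact ⟨G x, rfl, fun _ h => h⟩
  exact ⟨f, hfunc, fun x hx => (hfunc.pair_mem_iff.1 ((hf' x (G x)).2 ⟨hx, rfl⟩)).2⟩

theorem IsFunc.subset_iff {f a b g a' b' : V} (hf : IsFunc f a b) (hg : IsFunc g a' b') :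
    (∀ z, z ∊ f → z ∊ g) ↔ ∀ x, x ∊ a → x ∊ a' ∧ app g x = app f x := by
  constructor
  · intro h x hx
    exact hg.pair_mem_iff.1 (h _ (hf.pair_mem_iff.2 ⟨hx, rfl⟩))
  · intro h z hz
    obtain ⟨x, hx, rfl⟩ := hf.mem_iff.1 hz
    exact hg.pair_mem_iff.2 (h x hx)

theorem IsFunc.eq_of_app_eq {f a b g b' : V} (hf : IsFunc f a b) (hg : IsFunc g a b')
    (h : ∀ x, x ∊ a → app f x = app g x) : f = g :=
  In.ext fun z => ⟨(hf.subset_iff hg).2 (fun x hx => ⟨hx, (h x hx).symm⟩) z,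
    (hg.subset_iff hf).2 (fun x hx => ⟨hx, h x hx⟩) z⟩

theorem IsFunc.codomain {f a b b' : V} (hf : IsFunc f a b) (h : ∀ x, x ∊ a → app f x ∊ b') :
    IsFunc f a b' := by
  refine ⟨fun p hp => ?_, hf.2⟩
  obtain ⟨x, hx, rfl⟩ := hf.mem_iff.1 hp
  exact ⟨x, _, hx, h x hx, isOPair_iff.2 rfl⟩

theorem IsFunc.restrict {f a b a' : V} (hf : IsFunc f a b) (h : ∀ x, x ∊ a' → x ∊ a) :
    ∃ g : V, IsFunc g a' b ∧ ∀ x, x ∊ a' → app g x = app f x :=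
  exists_func a' b (fun x => app f x) fun x hx => hf.app_mem (h x hx)

/-! ### The natural numbers of a model -/

theorem isInductive_iff {I : V} :
    IsInductive I ↔ zero V ∊ I ∧ ∀ x, x ∊ I → adjoin x x ∊ I := by
  simp [IsInductive, isEmptySet_iff, isSucc_iff]

theorem isNatural_zero : IsNatural (zero V) := fun _ hI => (isInductive_iff.1 hI).1

theorem IsNatural.succ {n : V} (hn : IsNatural n) : IsNatural (adjoin n n) :=
  fun I hI => (isInductive_iff.1 hI).2 n (hn I hI)

/-- Separating the natural numbers with `P` from any inductive set leaves an inductive set, so the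
set of all natural numbers need not be formed. -/
theorem IsNatural.induction {P : V → Prop} [hP : DefinablePred (fun v : Fin 1 → V => P (v 0))]
    (h0 : P (zero V)) (hs : ∀ n, IsNatural n → P n → P (adjoin n n)) {n : V} (hn : IsNatural n) :
    P n := by
  obtain ⟨I, hI⟩ := hV.out.infinity
  obtain ⟨J, hJ⟩ := exists_sep I (fun x => IsNatural x ∧ P x)
  refine ((hJ n).1 (hn J (isInductive_iff.2 ⟨?_, fun x hx => ?_⟩))).2.2
  · exact (hJ _).2 ⟨(isInductive_iff.1 hI).1, isNatural_zero, h0⟩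
  · obtain ⟨h1, h2, h3⟩ := (hJ x).1 hx
    exact (hJ _).2 ⟨(isInductive_iff.1 hI).2 x h1, h2.succ, hs x h2 h3⟩

theorem IsNatural.mem {n m : V} (hn : IsNatural n) (hm : m ∊ n) : IsNatural m := by
  refine IsNatural.induction (P := fun n => ∀ m, m ∊ n → IsNatural m)
    (fun m hm => (notMem_zero m hm).elim) (fun n hn ih m hm => ?_) hn m hm
  rcases mem_adjoin.1 hm with h | rfl
  exacts [ih m h, hn]

theorem IsNatural.trans {n m k : V} (hn : IsNatural n) (hm : m ∊ n) (hk : k ∊ m) : k ∊ n := by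
  refine IsNatural.induction (P := fun n => ∀ m, m ∊ n → ∀ k, k ∊ m → k ∊ n)
    (fun m hm => (notMem_zero m hm).elim) (fun n hn ih m hm k hk => ?_) hn m hm k hk
  rcases mem_adjoin.1 hm with h | rfl
  exacts [mem_adjoin.2 (.inl (ih m h k hk)), mem_adjoin.2 (.inl hk)]

theorem IsNatural.zero_mem_succ {n : V} (hn : IsNatural n) : zero V ∊ adjoin n n := by
  refine IsNatural.induction (P := fun n => zero V ∊ adjoin n n)
    (mem_adjoin.2 (.inr rfl)) (fun n _ ih => mem_adjoin.2 (.inl ih)) hn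

theorem IsNatural.succ_mem_succ {n m : V} (hn : IsNatural n) (hm : m ∊ n) :
    adjoin m m ∊ adjoin n n := by
  refine IsNatural.induction (P := fun n => ∀ m, m ∊ n → adjoin m m ∊ adjoin n n)
    (fun m hm => (notMem_zero m hm).elim) (fun n hn ih m hm => ?_) hn m hm
  rcases mem_adjoin.1 hm with h | rfl
  exacts [mem_adjoin.2 (.inl (ih m h)), mem_adjoin.2 (.inr rfl)]

theorem IsNatural.trichotomy {n m : V} (hn : IsNatural n) (hm : IsNatural m) :
    m ∊ n ∨ m = n ∨ n ∊ m := by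
  refine IsNatural.induction (P := fun n => ∀ m, IsNatural m → m ∊ n ∨ m = n ∨ n ∊ m)
    (fun m hm => ?_) (fun n hn ih m hm => ?_) hn m hm
  · rcases mem_adjoin.1 hm.zero_mem_succ with h | h
    exacts [.inr (.inr h), .inr (.inl h.symm)]
  · rcases ih m hm with h | rfl | h
    · exact .inl (mem_adjoin.2 (.inl h))
    · exact .inl (mem_adjoin.2 (.inr rfl))
    · rcases mem_adjoin.1 (hm.succ_mem_succ h) with h | h
      exacts [.inr (.inr h), .inr (.inl h.symm)]

open Classical in
noncomputable instance : LinearOrder (Omega V) where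
  le m n := m = n ∨ m < n
  lt := (· < ·)
  le_refl m := .inl rfl
  le_trans a b c := by
    rintro (rfl | h) (rfl | h')
    exacts [.inl rfl, .inr h', .inr h, .inr (c.2.trans h' h)]
  lt_iff_le_not_ge a b := by
    constructor
    · refine fun h => ⟨.inr h, ?_⟩
      rintro (rfl | h')
      exacts [notMem_self _ h, notMem_self _ (a.2.trans h' h)]
    · rintro ⟨rfl | h, h'⟩
      exacts [(h' (.inl rfl)).elim, h]
  le_antisymm a b := by
    rintro (rfl | h) (h' | h')
    exacts [rfl, rfl, h'.symm, (notMem_self _ (a.2.trans h' h)).elim]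
  le_total a b := by
    rcases b.2.trichotomy a.2 with h | h | h
    exacts [.inl (.inr h), .inl (.inl (Subtype.ext h)), .inr (.inr h)]
  toDecidableLE := Classical.decRel _

/-- The element `m` of the natural number `n`, as a natural number. -/
def Omega.ofMem (n : Omega V) {m : V} (h : m ∊ n.1) : Omega V := ⟨m, n.2.mem h⟩

/-- The successor of a natural number of `V`. -/
noncomputable def Omega.succ (n : Omega V) : Omega V := ⟨adjoin n.1 n.1, n.2.succ⟩

noncomputable instance : OrderBot (Omega V) where
  bot := ⟨zero V, isNatural_zero⟩
  bot_le n := by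
    rcases mem_adjoin.1 n.2.zero_mem_succ with h | h
    exacts [.inr h, .inl (Subtype.ext h)]

theorem Omega.lt_succ_iff {m n : Omega V} : m < n.succ ↔ m ≤ n :=
  mem_adjoin.trans ⟨fun h => h.symm.imp Subtype.ext id, fun h => h.symm.imp id (congrArg _)⟩

theorem Omega.lt_succ (n : Omega V) : n < n.succ := Omega.lt_succ_iff.2 le_rfl

theorem Omega.succ_le_iff {m n : Omega V} : m.succ ≤ n ↔ m < n := by
  rw [← not_lt, Omega.lt_succ_iff, not_le]

theorem Omega.mem_of_mem_of_le {m n : Omega V} {x : V} (hx : x ∊ m.1) (h : m ≤ n) : x ∊ n.1 :=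
  lt_of_lt_of_le (a := m.ofMem hx) (b := m) hx h

theorem Omega.eq_bot_or_succ (n : Omega V) : n = ⊥ ∨ ∃ m : Omega V, n = m.succ := by
  have := IsNatural.induction (P := fun n : V => n = zero V ∨ ∃ m, IsNatural m ∧ n = adjoin m m)
    (.inl rfl) (fun n hn _ => .inr ⟨n, hn, rfl⟩) n.2
  rcases this with h | ⟨m, hm, h⟩
  exacts [.inl (Subtype.ext h), .inr ⟨⟨m, hm⟩, Subtype.ext h⟩]

/-- The least number principle for definable predicates. -/
theorem Omega.exists_least (P : V → Prop) [hP : DefinablePred (fun v : Fin 1 → V => P (v 0))]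
    {n : Omega V} (hn : P n.1) : ∃ m : Omega V, P m.1 ∧ ∀ k < m, ¬ P k.1 := by
  obtain ⟨s, hs⟩ := exists_sep (adjoin n.1 n.1) P
  obtain ⟨y, hy, hy'⟩ := hV.out.foundation s ⟨n.1, (hs _).2 ⟨mem_adjoin.2 (.inr rfl), hn⟩⟩
  obtain ⟨h1, h2⟩ := (hs y).1 hy
  exact ⟨⟨y, n.2.succ.mem h1⟩, h2, fun k hk hPk =>
    hy' k.1 ((hs _).2 ⟨n.2.succ.trans h1 hk, hPk⟩) hk⟩

end SetTheory

end ZFCMinus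

namespace ZFCMinus

/-! ### Finite sets of a model -/

section FiniteSets

variable {V : Type u} [setLang.Structure V] [hV : Fact (ModelsZFCMinus V)]

/-- `f` is one-to-one on `X`. -/
def InjOn (f X : V) : Prop := ∀ x y : V, x ∊ X → y ∊ X → app f x = app f y → x = y

theorem definablePred_injOn : DefinablePred (fun v : Fin 2 → V => InjOn (v 0) (v 1)) := by
  unfold InjOn; infer_instance

instance {α : Type} {t t' : (α → V) → V} [DefinableFn t] [DefinableFn t'] :
    DefinablePred (fun v => InjOn (t v) (t' v)) :=
  definablePred_injOn.comp₂

/-- `V ⊨` "`X` is finite". -/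
def VFinite (X : V) : Prop := ∃ n f : V, IsNatural n ∧ IsFunc f X n ∧ InjOn f X

theorem definablePred_vFinite : DefinablePred (fun v : Fin 1 → V => VFinite (v 0)) := by
  unfold VFinite; infer_instance

instance {α : Type} {t : (α → V) → V} [DefinableFn t] : DefinablePred (fun v => VFinite (t v)) :=
  definablePred_vFinite.comp₁

/-- Induction on the bound `n` of an injection into `n`, for all sets and injections at once: the
element sent to the last value, if there is one, is removed. -/
theorem VFinite.induction {P : V → Prop} [hP : DefinablePred (fun v : Fin 1 → V => P (v 0))]
    (h0 : P (zero V)) (hs : ∀ X x, VFinite X → P X → ¬ x ∊ X → P (adjoin X x)) {X : V}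
    (hX : VFinite X) : P X := by
  have key : ∀ {α : Type} (t : (α → V) → V) [DefinableFn t], DefinablePred (fun v => P (t v)) :=
    fun t _ => hP.comp₁
  obtain ⟨n, f, hn, hf, hi⟩ := hX
  refine IsNatural.induction (P := fun n => ∀ X f, IsFunc f X n → InjOn f X → P X)
    ?_ ?_ hn X f hf hi
  · intro X f hf _
    have : X = zero V :=
      In.ext fun z => iff_of_false (fun hz => notMem_zero _ (hf.app_mem hz)) (notMem_zero z)
    exact this ▸ h0
  · intro n hn ih X f hf hi
    by_cases h : ∃ x, x ∊ X ∧ app f x = n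
    · obtain ⟨x, hx, hxn⟩ := h
      obtain ⟨Y, hY⟩ := exists_sep X (fun y => y ≠ x)
      obtain ⟨g, hg, hgf⟩ := hf.restrict (fun y hy => ((hY y).1 hy).1)
      have hg' : IsFunc g Y n := by
        refine hg.codomain fun y hy => ?_
        rw [hgf y hy]
        rcases mem_adjoin.1 (hf.app_mem ((hY y).1 hy).1) with h | h
        · exact h
        · exact (((hY y).1 hy).2 (hi y x ((hY y).1 hy).1 hx (h.trans hxn.symm))).elim
      have hgi : InjOn g Y := by
        intro y z hy hz e
        rw [hgf y hy, hgf z hz] at e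
        exact hi y z ((hY y).1 hy).1 ((hY z).1 hz).1 e
      have hXY : X = adjoin Y x := by
        refine In.ext fun z => ?_
        rw [mem_adjoin, hY]
        by_cases hzx : z = x
        · simp [hzx, hx]
        · simp [hzx]
      rw [hXY]
      exact hs Y x ⟨n, g, hn, hg', hgi⟩ (ih Y g hg' hgi) (fun h => ((hY x).1 h).2 rfl)
    · refine ih X f (hf.codomain fun x hx => ?_) hi
      rcases mem_adjoin.1 (hf.app_mem hx) with h' | h'
      exacts [h', (h ⟨x, hx, h'⟩).elim]

theorem VFinite.zero : VFinite (zero V) := by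
  obtain ⟨f, hf, -⟩ := exists_func (ZFCMinus.zero V) (ZFCMinus.zero V) (fun x => x)
    (fun x hx => hx)
  exact ⟨_, f, isNatural_zero, hf, fun x _ hx => (notMem_zero x hx).elim⟩

theorem IsNatural.vFinite {n : V} (hn : IsNatural n) : VFinite n := by
  obtain ⟨f, hf, hf'⟩ := exists_func n n (fun x => x) (fun x hx => hx)
  exact ⟨n, f, hn, hf, fun x y hx hy h => by rwa [hf' x hx, hf' y hy] at h⟩

theorem adjoin_of_mem {X x : V} (h : x ∊ X) : adjoin X x = X :=
  In.ext fun z => by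
    rw [mem_adjoin]
    exact ⟨fun h' => h'.elim id (fun e => e ▸ h), .inl⟩

open Classical in
theorem VFinite.adjoin {X : V} (hX : VFinite X) (x : V) : VFinite (adjoin X x) := by
  by_cases hx : x ∊ X
  · rwa [adjoin_of_mem hx]
  obtain ⟨n, f, hn, hf, hi⟩ := hX
  obtain ⟨g, hg, hg'⟩ := exists_func (ZFCMinus.adjoin X x) (ZFCMinus.adjoin n n)
    (fun y => if y = x then n else app f y) (by
      intro y hy
      split_ifs with h
      · simp
      · exact mem_adjoin.2 (.inl (hf.app_mem ((mem_adjoin.1 hy).resolve_right h))))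
  refine ⟨_, g, hn.succ, hg, fun y z hy hz h => ?_⟩
  rw [hg' y hy, hg' z hz] at h
  have hmem : ∀ y, y ∊ ZFCMinus.adjoin X x → y ≠ x → y ∊ X := fun y hy h =>
    (mem_adjoin.1 hy).resolve_right h
  split_ifs at h with h1 h2 h2
  · rw [h1, h2]
  · exact (notMem_self n (h ▸ hf.app_mem (hmem z hz h2))).elim
  · exact (notMem_self n (h ▸ hf.app_mem (hmem y hy h1))).elim
  · exact hi y z (hmem y hy h1) (hmem z hz h2) h

theorem VFinite.union {X Y : V} (hX : VFinite X) (hY : VFinite Y) :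
    ∃ u, VFinite u ∧ ∀ z, z ∊ u ↔ z ∊ X ∨ z ∊ Y := by
  refine VFinite.induction (P := fun Y => ∃ u, VFinite u ∧ ∀ z, z ∊ u ↔ z ∊ X ∨ z ∊ Y)
    ⟨X, hX, fun z => by simp [notMem_zero]⟩ ?_ hY
  rintro Y y - ⟨u, hu, hu'⟩ -
  exact ⟨_, hu.adjoin y, fun z => by simp [hu', or_assoc]⟩

theorem VFinite.biUnion {X : V} (hX : VFinite X) (R : V → V → Prop)
    [hR : DefinablePred (fun v : Fin 2 → V => R (v 0) (v 1))]
    (h : ∀ x, x ∊ X → ∃ u : V, VFinite u ∧ ∀ z, z ∊ u ↔ R x z) :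
    ∃ b : V, VFinite b ∧ ∀ z, z ∊ b ↔ ∃ x, x ∊ X ∧ R x z := by
  have key : ∀ {α : Type} (t t' : (α → V) → V) [DefinableFn t] [DefinableFn t'],
      DefinablePred (fun v => R (t v) (t' v)) := fun t t' _ _ => hR.comp₂
  refine VFinite.induction (P := fun X => (∀ x, x ∊ X → ∃ u : V, VFinite u ∧ ∀ z, z ∊ u ↔ R x z) →
    ∃ b : V, VFinite b ∧ ∀ z, z ∊ b ↔ ∃ x, x ∊ X ∧ R x z) ?_ ?_ hX h
  · exact fun _ => ⟨_, VFinite.zero, fun z => by simp [notMem_zero]⟩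
  · intro X x _ ih _ h
    obtain ⟨b, hb, hb'⟩ := ih fun y hy => h y (mem_adjoin.2 (.inl hy))
    obtain ⟨u, hu, hu'⟩ := h x (mem_adjoin.2 (.inr rfl))
    obtain ⟨c, hc, hc'⟩ := hb.union hu
    refine ⟨c, hc, fun z => ?_⟩
    simp only [hc', hb', hu', mem_adjoin, or_and_right, exists_or, exists_eq_left]

theorem VFinite.image {X : V} (hX : VFinite X) (G : V → V)
    [hG : DefinableFn (fun v : Fin 1 → V => G (v 0))] :
    ∃ b : V, VFinite b ∧ ∀ z, z ∊ b ↔ ∃ x, x ∊ X ∧ z = G x := by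
  have : DefinableFn (fun v : Fin 2 → V => G (v 0)) := hG.comp₁
  exact hX.biUnion (fun x z => z = G x) fun x _ =>
    ⟨_, VFinite.zero.adjoin (G x), fun z => by simp [notMem_zero]⟩

theorem IsFunc.adjoin {s X Y x y : V} (hs : IsFunc s X Y) (hx : ¬ x ∊ X) (hy : y ∊ Y) :
    IsFunc (adjoin s (opair x y)) (adjoin X x) Y := by
  refine ⟨fun p hp => ?_, fun z hz => ?_⟩
  · rcases mem_adjoin.1 hp with h | rfl
    · obtain ⟨z, hz, rfl⟩ := hs.mem_iff.1 h
      exact ⟨z, _, mem_adjoin.2 (.inl hz), hs.app_mem hz, isOPair_iff.2 rfl⟩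
    · exact ⟨x, y, mem_adjoin.2 (.inr rfl), hy, isOPair_iff.2 rfl⟩
  · simp only [pairIn_iff, mem_adjoin, opair_inj, hs.pair_mem_iff]
    rcases mem_adjoin.1 hz with h | rfl
    · exact ⟨app s z, .inl ⟨h, rfl⟩, fun w hw => hw.elim (fun h => h.2.symm)
        fun h' => (hx (h'.1 ▸ h)).elim⟩
    · exact ⟨y, .inr ⟨rfl, rfl⟩, fun w hw => hw.elim (fun h => (hx h.1).elim) fun h => h.2⟩

/-- The functions between two finite sets form a finite set. -/
theorem VFinite.funcs {X Y : V} (hX : VFinite X) (hY : VFinite Y) :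
    ∃ F : V, VFinite F ∧ ∀ s, s ∊ F ↔ IsFunc s X Y := by
  refine VFinite.induction (P := fun X => ∃ F : V, VFinite F ∧ ∀ s, s ∊ F ↔ IsFunc s X Y) ?_ ?_ hX
  · refine ⟨_, VFinite.zero.adjoin (ZFCMinus.zero V), fun s => ?_⟩
    have h0 : IsFunc (ZFCMinus.zero V) (ZFCMinus.zero V) Y :=
      ⟨fun p hp => (notMem_zero p hp).elim, fun p hp => (notMem_zero p hp).elim⟩
    simp only [mem_adjoin, notMem_zero, false_or]
    exact ⟨fun h => h ▸ h0, fun h => h.eq_of_app_eq h0 fun x hx => (notMem_zero x hx).elim⟩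
  · rintro X x - ⟨F, hF, hF'⟩ hx
    -- Functions on `X ∪ {x}` are the one-point extensions of functions on `X`, with finitely many
    -- choices of the new value.
    obtain ⟨b, hb, hb'⟩ := hF.biUnion (fun s z => ∃ y, y ∊ Y ∧ z = ZFCMinus.adjoin s (opair x y))
      fun s _ => hY.image fun y => ZFCMinus.adjoin s (opair x y)
    refine ⟨b, hb, fun z => (hb' z).trans ⟨?_, fun hz => ?_⟩⟩
    · rintro ⟨s, hs, y, hy, rfl⟩
      exact ((hF' s).1 hs).adjoin hx hy
    · obtain ⟨s, hs, hs'⟩ := hz.restrict (a' := X) fun y hy => mem_adjoin.2 (.inl hy)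
      refine ⟨s, (hF' s).2 hs, app z x, hz.app_mem (by simp), In.ext fun p => ?_⟩
      rw [mem_adjoin, hz.mem_iff, hs.mem_iff]
      constructor
      · rintro ⟨y, hy, rfl⟩
        rcases mem_adjoin.1 hy with h | rfl
        exacts [.inl ⟨y, h, by rw [hs' y h]⟩, .inr rfl]
      · rintro (⟨y, hy, rfl⟩ | rfl)
        exacts [⟨y, mem_adjoin.2 (.inl hy), by rw [hs' y hy]⟩, ⟨x, by simp, rfl⟩]

open Classical in
/-- A finite linear order embeds into the natural numbers. -/
theorem VFinite.exists_order_embedding {X : V} (hX : VFinite X) (R : V → V → Prop)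
    [hR : DefinablePred (fun v : Fin 2 → V => R (v 0) (v 1))]
    (irrefl : ∀ x, x ∊ X → ¬ R x x)
    (trans : ∀ x y z, x ∊ X → y ∊ X → z ∊ X → R x y → R y z → R x z) :
    ∃ N f : V, IsNatural N ∧ IsFunc f X N ∧
      ∀ x y, x ∊ X → y ∊ X → R x y → app f x ∊ app f y := by
  have key : ∀ {α : Type} (t t' : (α → V) → V) [DefinableFn t] [DefinableFn t'],
      DefinablePred (fun v => R (t v) (t' v)) := fun t t' _ _ => hR.comp₂
  refine VFinite.induction (P := fun Y => (∀ x, x ∊ Y → x ∊ X) → ∃ N f : V, IsNatural N ∧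
    IsFunc f Y N ∧ ∀ x y, x ∊ Y → y ∊ Y → R x y → app f x ∊ app f y) ?_ ?_ hX (fun _ h => h)
  · intro _
    obtain ⟨n, f, hn, hf, -⟩ := VFinite.zero (V := V)
    exact ⟨n, f, hn, hf, fun x _ hx => (notMem_zero x hx).elim⟩
  · intro Y a _ ih haY hYX
    obtain ⟨N, f, hN, hf, hmono⟩ := ih fun x hx => hYX x (mem_adjoin.2 (.inl hx))
    have haX := hYX a (mem_adjoin.2 (.inr rfl))
    have hY : ∀ x, x ∊ Y → x ∊ X := fun x hx => hYX x (mem_adjoin.2 (.inl hx))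
    -- The new element goes to the least strict upper bound `k` of the values below it; everything
    -- above it is moved up by one to make room.
    obtain ⟨k, hk, hkmin⟩ := Omega.exists_least (n := ⟨N, hN⟩)
      (fun k => ∀ x, x ∊ Y → R x a → app f x ∊ k) (fun x hx _ => hf.app_mem hx)
    have hkN : k ≤ ⟨N, hN⟩ := not_lt.1 fun h => hkmin _ h fun x hx _ => hf.app_mem hx
    obtain ⟨g, hg, hg'⟩ := exists_func (ZFCMinus.adjoin Y a) (ZFCMinus.adjoin N N)
      (fun y => if y = a then k.1 else if R a y then ZFCMinus.adjoin (app f y) (app f y)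
        else app f y) (by
        intro y hy
        split_ifs with h1 h2
        · exact Omega.lt_succ_iff.2 hkN
        · exact hN.succ_mem_succ (hf.app_mem ((mem_adjoin.1 hy).resolve_right h1))
        · exact mem_adjoin.2 (.inl (hf.app_mem ((mem_adjoin.1 hy).resolve_right h1))))
    refine ⟨_, g, hN.succ, hg, fun x y hx hy hxy => ?_⟩
    rw [hg' x hx, hg' y hy]
    by_cases hxa : x = a
    · subst hxa
      have hyx : y ≠ x := fun e => irrefl x haX (e ▸ hxy)
      have hyY := (mem_adjoin.1 hy).resolve_right hyx
      rw [if_pos rfl, if_neg hyx, if_pos hxy]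
      let m : Omega V := ⟨app f y, hN.mem (hf.app_mem hyY)⟩
      have : k ≤ m := not_lt.1 fun h => hkmin m h fun z hz hzx =>
        hmono z y hz hyY (trans z x y (hY z hz) haX (hY y hyY) hzx hxy)
      exact Omega.lt_succ_iff.2 this
    · have hxY := (mem_adjoin.1 hx).resolve_right hxa
      rw [if_neg hxa]
      by_cases hya : y = a
      · subst hya
        rw [if_pos rfl, if_neg fun h => irrefl x (hY x hxY) (trans _ _ _ (hY x hxY) haX
          (hY x hxY) hxy h)]
        exact hk x hxY hxy
      · have hyY := (mem_adjoin.1 hy).resolve_right hya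
        rw [if_neg hya]
        have h1 := hmono x y hxY hyY hxy
        by_cases hax : R a x
        · rw [if_pos hax, if_pos (trans a x y haX (hY x hxY) (hY y hyY) hax hxy)]
          exact (hN.mem (hf.app_mem hyY)).succ_mem_succ h1
        · rw [if_neg hax]
          split_ifs
          exacts [mem_adjoin.2 (.inl h1), h1]

theorem IsFunc.exists_max {X f N : V} (hN : IsNatural N) (hf : IsFunc f X N) (P : V → Prop)
    [hP : DefinablePred (fun v : Fin 1 → V => P (v 0))] (h : ∃ x, x ∊ X ∧ P x) :
    ∃ x, x ∊ X ∧ P x ∧ ∀ y, y ∊ X → P y → ¬ app f x ∊ app f y := by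
  have key : ∀ {α : Type} (t : (α → V) → V) [DefinableFn t], DefinablePred (fun v => P (t v)) :=
    fun t _ => hP.comp₁
  obtain ⟨k, hk, hkmin⟩ := Omega.exists_least (n := ⟨N, hN⟩)
      (fun k => ∀ x, x ∊ X → P x → app f x ∊ k) (fun x hx _ => hf.app_mem hx)
  rcases k.eq_bot_or_succ with rfl | ⟨m, rfl⟩
  · obtain ⟨x, hx, hPx⟩ := h
    exact (notMem_zero _ (hk x hx hPx)).elim
  -- The least strict upper bound of the values is a successor, and its predecessor is attained.
  · have := hkmin m m.lt_succ
    push Not at this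
    obtain ⟨x, hx, hPx, hxm⟩ := this
    refine ⟨x, hx, hPx, fun y hy hPy hxy => ?_⟩
    have e : app f x = m.1 := (mem_adjoin.1 (hk x hx hPx)).resolve_left hxm
    rcases mem_adjoin.1 (hk y hy hPy) with h1 | h1
    · exact notMem_self _ (m.2.trans h1 (e ▸ hxy))
    · exact notMem_self m.1 (by rw [e, h1] at hxy; exact hxy)

/-- A finite linear order `X` embeds into the natural numbers so that every natural number which
is not below the image of `X` is rounded down to an element of `X`. -/
theorem VFinite.exists_rounded_embedding {X : V} (hX : VFinite X) (R : V → V → Prop)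
    [hR : DefinablePred (fun v : Fin 2 → V => R (v 0) (v 1))]
    (irrefl : ∀ x, x ∊ X → ¬ R x x)
    (trans : ∀ x y z, x ∊ X → y ∊ X → z ∊ X → R x y → R y z → R x z)
    (total : ∀ x y, x ∊ X → y ∊ X → x = y ∨ R x y ∨ R y x) :
    ∃ e : V → Omega V, (∀ x y, x ∊ X → y ∊ X → R x y → e x < e y) ∧
      ∀ c : Omega V, (∃ x, x ∊ X ∧ e x ≤ c) → ∃ x, x ∊ X ∧
        (∀ y, y ∊ X → e y ≤ c → y = x ∨ R y x) ∧ ∀ y, y ∊ X → c < e y → R x y := by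
  obtain ⟨N, f, hN, hf, hmono⟩ := hX.exists_order_embedding R irrefl trans
  classical
  let e : V → Omega V := fun x => if h : x ∊ X then ⟨app f x, hN.mem (hf.app_mem h)⟩ else ⊥
  have he : ∀ x, x ∊ X → (e x).1 = app f x := fun x hx => by simp [e, hx]
  have hmono' : ∀ x y, x ∊ X → y ∊ X → R x y → e x < e y := fun x y hx hy hxy => by
    rw [Omega.lt_def, he x hx, he y hy]
    exact hmono x y hx hy hxy
  have hle : ∀ c : Omega V, ∀ x, x ∊ X → (e x ≤ c ↔ ¬ c.1 ∊ app f x) := fun c x hx => by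
    rw [← he x hx, ← Omega.lt_def, not_lt]
  refine ⟨e, hmono', fun c ⟨x, hx, hxc⟩ => ?_⟩
  obtain ⟨y, hy, hyc, hmax⟩ := hf.exists_max hN (fun x => ¬ c.1 ∊ app f x)
    ⟨x, hx, (hle c x hx).1 hxc⟩
  refine ⟨y, hy, fun z hz hzc => ?_, fun z hz hzc => ?_⟩
  · rcases total z y hz hy with h | h | h
    · exact .inl h
    · exact .inr h
    · exact (hmax z hz ((hle c z hz).1 hzc) (hmono y z hy hz h)).elim
  · rcases total z y hz hy with rfl | h | h
    · exact (not_lt.2 ((hle c z hz).2 hyc) hzc).elim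
    · exact (not_lt.2 ((hle c y hy).2 hyc) (hzc.trans (hmono' z y hz hy h))).elim
    · exact h

end FiniteSets

end ZFCMinus

namespace ZFCMinus

/-! ### Cofinal sequences -/

section Cofinality

-- Well-order `L` and keep the elements that exceed all their predecessors. They are cofinal, and on
-- them the order of `L` agrees with the well-order; a cofinal subset of least order type then has
-- regular length.
open Ordinal in
theorem exists_strictMono_cofinal (L : Type u) [LinearOrder L] [Nonempty L] [NoMaxOrder L] :
    ∃ κ : Cardinal.{u}, κ.IsRegular ∧ κ ≤ #L ∧
      ∃ f : κ.ord.ToType → L, StrictMono f ∧ ∀ x, ∃ i, x ≤ f i := by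
  obtain ⟨r, hr, -⟩ := Cardinal.exists_ord_eq L
  let S : Set L := {a | ∀ b, r b a → b < a}
  have hS : IsCofinal S := isCofinal_setOfPred_imp_lt r
  have hwf : WellFoundedLT S := by
    refine ⟨Subrelation.wf (r := fun a b : S => r a.1 b.1) ?_ (InvImage.wf _ hr.wf)⟩
    intro a b hab
    rcases trichotomous_of r a.1 b.1 with h | h | h
    · exact h
    · exact (hab.ne (Subtype.ext h)).elim
    · exact ((a.2 _ h).asymm hab).elim
  obtain ⟨T, hT, hT'⟩ := Ordinal.exists_ord_cof_eq S
  have hcof : Order.cof S = Order.cof L := Order.cof_eq_of_isCofinal hS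
  rw [hcof] at hT'
  have hiso : typeLT (Order.cof L).ord.ToType = typeLT T := by rw [hT', Ordinal.type_toType]
  obtain ⟨φ⟩ := Ordinal.type_eq.1 hiso
  refine ⟨Order.cof L, ⟨Order.aleph0_le_cof, ?_⟩, Order.cof_le_cardinalMk L,
    fun i => (φ i).1.1, ?_, ?_⟩
  · rw [← hcof, Order.cof_ord_cof]
  · intro i j hij
    exact φ.map_rel_iff.2 hij
  · intro x
    obtain ⟨y, hy, hxy⟩ := hS x
    obtain ⟨z, hz, hyz⟩ := hT ⟨y, hy⟩
    exact ⟨φ.symm ⟨z, hz⟩, by simpa using hxy.trans hyz⟩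

/-- A cofinal subsequence of regular length is still unbounded, so minimality makes the length
itself regular. -/
theorem IsTreeTops.isRegular {T : Type u} [Preorder T] [Nonempty T] {κ : Cardinal.{u}}
    (h : IsTreeTops T κ) : κ.IsRegular := by
  obtain ⟨⟨s, hs, hub⟩, hmin⟩ := h
  have : Nonempty κ.ord.ToType := by
    by_contra hne
    rw [not_nonempty_iff] at hne
    exact hub (by rw [Set.range_eq_empty]; exact bddAbove_empty)
  have : NoMaxOrder κ.ord.ToType := by
    refine ⟨fun i => ?_⟩
    by_contra hi
    push Not at hi
    exact hub ⟨s i, by rintro _ ⟨j, rfl⟩; exact hs.monotone (hi j)⟩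
  obtain ⟨μ, hμ, hle, f, hf, hcof⟩ := exists_strictMono_cofinal κ.ord.ToType
  rw [Cardinal.mk_ord_toType] at hle
  have : κ ≤ μ := by
    refine hmin ⟨s ∘ f, hs.comp hf, fun ⟨t, ht⟩ => hub ⟨t, ?_⟩⟩
    rintro _ ⟨i, rfl⟩
    obtain ⟨j, hj⟩ := hcof i
    exact (hs.monotone hj).trans (ht ⟨j, rfl⟩)
  exact hle.antisymm this ▸ hμ

end Cofinality

/-! ### Cuts from unbounded sequences in trees -/

section Lexicographic

variable {V : Type u} [setLang.Structure V] [hV : Fact (ModelsZFCMinus V)]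

open Classical in
theorem IsFunc.exists_leftInverse {f X Y d : V} (hf : IsFunc f X Y) (hi : InjOn f X)
    (hd : d ∊ X) : ∃ g : V, IsFunc g Y X ∧ ∀ x, x ∊ X → app g (app f x) = x := by
  obtain ⟨r, hr⟩ := exists_image X (fun x => opair (app f x) x)
  have hr' : ∀ x, x ∊ X → app r (app f x) = x := by
    intro x hx
    have h : ∃! y, PairIn r (app f x) y := by
      refine ⟨x, pairIn_iff.2 ((hr _).2 ⟨x, hx, rfl⟩), fun y hy => ?_⟩
      obtain ⟨z, hz, e⟩ := (hr _).1 (pairIn_iff.1 hy)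
      obtain ⟨e1, rfl⟩ := opair_inj.1 e
      exact hi _ _ hz hx e1.symm
    rw [app, dif_pos h]
    exact h.unique h.choose_spec.1 (pairIn_iff.2 ((hr _).2 ⟨x, hx, rfl⟩))
  obtain ⟨g, hg, hg'⟩ := exists_func Y X
    (fun y => if ∃ x, x ∊ X ∧ app f x = y then app r y else d) (by
      intro y hy
      split_ifs with h
      · obtain ⟨x, hx, rfl⟩ := h
        rwa [hr' x hx]
      · exact hd)
  refine ⟨g, hg, fun x hx => ?_⟩
  rw [hg' _ (hf.app_mem hx), if_pos ⟨x, hx, rfl⟩, hr' x hx]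

/-- The lexicographic order of functions on the natural number `N`. -/
def LexLT (N x y : V) : Prop :=
  ∃ i, i ∊ N ∧ (∀ j, j ∊ i → app x j = app y j) ∧ app x i ∊ app y i

theorem definablePred_lexLT :
    DefinablePred (fun v : Fin 3 → V => LexLT (v 0) (v 1) (v 2)) := by
  unfold LexLT; infer_instance

instance {α : Type} {t t' t'' : (α → V) → V} [DefinableFn t] [DefinableFn t'] [DefinableFn t''] :
    DefinablePred (fun v => LexLT (t v) (t' v) (t'' v)) :=
  definablePred_lexLT.comp₃

theorem LexLT.irrefl {N x : V} : ¬ LexLT N x x := fun ⟨_, _, _, h⟩ => notMem_self _ h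

theorem LexLT.trans {N M x y z : V} (hN : IsNatural N) (hM : IsNatural M) (hz : IsFunc z N M)
    (hxy : LexLT N x y) (hyz : LexLT N y z) : LexLT N x z := by
  obtain ⟨i, hi, hij, hlt⟩ := hxy
  obtain ⟨i', hi', hij', hlt'⟩ := hyz
  rcases (hN.mem hi).trichotomy (hN.mem hi') with h | rfl | h
  · refine ⟨i', hi', fun j hj => ?_, ?_⟩
    · rw [hij j ((hN.mem hi).trans h hj), hij' j hj]
    · rw [hij i' h]
      exact hlt'
  · exact ⟨i', hi', fun j hj => (hij j hj).trans (hij' j hj),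
      (hM.mem (hz.app_mem hi')).trans hlt' hlt⟩
  · refine ⟨i, hi, fun j hj => ?_, ?_⟩
    · rw [hij j hj, hij' j ((hN.mem hi').trans h hj)]
    · rw [← hij' i h]
      exact hlt

theorem LexLT.total {N M x y : V} (hN : IsNatural N) (hM : IsNatural M) (hx : IsFunc x N M)
    (hy : IsFunc y N M) : x = y ∨ LexLT N x y ∨ LexLT N y x := by
  by_cases h : ∀ i, i ∊ N → app x i = app y i
  · exact .inl (hx.eq_of_app_eq hy h)
  · right
    push Not at h
    obtain ⟨k, hk, hne⟩ := h
    obtain ⟨i, hi, hmin⟩ := Omega.exists_least (n := ⟨k, hN.mem hk⟩)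
      (fun i => i ∊ N ∧ app x i ≠ app y i) ⟨hk, hne⟩
    have hj : ∀ j, j ∊ i.1 → app x j = app y j := fun j hj => by
      by_contra hne
      exact hmin (i.ofMem hj) hj ⟨hN.trans hi.1 hj, hne⟩
    rcases (hM.mem (hx.app_mem hi.1)).trichotomy (hM.mem (hy.app_mem hi.1)) with h | h | h
    · exact .inr ⟨i.1, hi.1, fun j h => (hj j h).symm, h⟩
    · exact (hi.2 h.symm).elim
    · exact .inl ⟨i.1, hi.1, hj, h⟩

variable {n : Omega V}

/-- The length of an element of `n^{<n}`. -/
noncomputable def SeqTree.length (s : SeqTree n) : Omega V := n.ofMem s.2.choose_spec.1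

theorem SeqTree.length_lt (s : SeqTree n) : s.length < n := s.2.choose_spec.1

theorem SeqTree.isFunc (s : SeqTree n) : IsFunc s.1 s.length.1 n.1 := s.2.choose_spec.2

theorem Omega.le_of_subset {m k : Omega V} (h : ∀ x, x ∊ m.1 → x ∊ k.1) : m ≤ k :=
  not_lt.1 fun hk => notMem_self _ (h _ hk)

theorem SeqTree.app_eq {s t : SeqTree n} (h : s ≤ t) {i : V} (hi : i ∊ s.length.1) :
    app t.1 i = app s.1 i :=
  ((s.isFunc.subset_iff t.isFunc).1 h i hi).2

theorem SeqTree.length_lt_length {s t : SeqTree n} (h : s < t) : s.length < t.length := by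
  have h1 := (s.isFunc.subset_iff t.isFunc).1 h.le
  refine lt_of_le_of_ne (Omega.le_of_subset fun x hx => (h1 x hx).1) fun e => h.not_ge ?_
  refine (t.isFunc.subset_iff s.isFunc).2 fun x hx => ?_
  rw [← e] at hx
  exact ⟨hx, (h1 x hx).2.symm⟩

open Classical in
/-- A sequence `s` in `n^{<n}` is turned into a function on `n`: its values are shifted by one,
the value `d` is put behind them, and all other values are `0`. -/
theorem SeqTree.exists_pad (s : SeqTree n) {d : V} (hd : d ∊ n.succ.succ.1) :
    ∃ f : V, IsFunc f n.1 n.succ.succ.1 ∧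
      (∀ i, i ∊ s.length.1 → app f i = adjoin (app s.1 i) (app s.1 i)) ∧
      app f s.length.1 = d := by
  -- Every place from the length of `s` on receives `d`; only the first of them is used.
  obtain ⟨f, hf, hf'⟩ := exists_func n.1 n.succ.succ.1
    (fun i => if i ∊ s.length.1 then adjoin (app s.1 i) (app s.1 i) else d) (by
      intro i _
      split_ifs with h
      · exact mem_adjoin.2 (.inl (n.2.succ_mem_succ (s.isFunc.app_mem h)))
      · exact hd)
  refine ⟨f, hf, fun i hi => ?_, ?_⟩
  · rw [hf' i (n.2.trans s.length_lt hi), if_pos hi]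
  · rw [hf' _ s.length_lt, if_neg (notMem_self _)]

/-- The pairs of equal length in the cut spectrum that are given by tree-tops numbers. -/
theorem mem_cutSpectrumOmega_of_isTreeTops (hn : ∃ m : Omega V, m < n) {κ : Cardinal.{u}}
    (hκ : IsTreeTops (SeqTree n) κ) : (κ, κ) ∈ cutSpectrumOmega V := by
  have hn0 : zero V ∊ n.1 := by
    obtain ⟨m, hm⟩ := hn
    exact lt_of_le_of_lt (bot_le (a := m)) hm
  have : Nonempty (SeqTree n) := by
    obtain ⟨f, hf, -⟩ := exists_func (zero V) n.1 (fun x => x) fun x hx => (notMem_zero x hx).elim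
    exact ⟨⟨f, _, hn0, hf⟩⟩
  have hreg := hκ.isRegular
  have : NoMaxOrder κ.ord.ToType := Cardinal.noMaxOrder hreg.aleph0_le
  obtain ⟨⟨s, hs, hub⟩, -⟩ := hκ
  have hM : IsNatural n.succ.succ.1 := n.succ.succ.2
  -- Shifted values lie in `1, …, n`, so the end marks `0` for `A` and `n+1` for `B` are below and
  -- above all of them.
  choose A hA hAs hA0 using fun α => (s α).exists_pad (d := zero V)
    (lt_of_le_of_lt (bot_le (a := n)) (n.lt_succ.trans n.succ.lt_succ))
  choose B hB hBs hB0 using fun α => (s α).exists_pad (d := n.succ.1) n.succ.lt_succ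
  have hAA : ∀ α β, α < β → LexLT n.1 (A α) (A β) := by
    intro α β hαβ
    have hlt := SeqTree.length_lt_length (hs hαβ)
    refine ⟨(s α).length.1, (s α).length_lt, fun j hj => ?_, ?_⟩
    · rw [hAs α j hj, hAs β j ((s β).length.2.trans hlt hj), SeqTree.app_eq (hs hαβ).le hj]
    · rw [hA0 α, hAs β _ hlt]
      exact (n.2.mem ((s β).isFunc.app_mem hlt)).zero_mem_succ
  have hBB : ∀ α β, α < β → LexLT n.1 (B β) (B α) := by
    intro α β hαβ
    have hlt := SeqTree.length_lt_length (hs hαβ)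
    refine ⟨(s α).length.1, (s α).length_lt, fun j hj => ?_, ?_⟩
    · rw [hBs α j hj, hBs β j ((s β).length.2.trans hlt hj), SeqTree.app_eq (hs hαβ).le hj]
    · rw [hB0 α, hBs β _ hlt]
      exact n.2.succ_mem_succ ((s β).isFunc.app_mem hlt)
  have hAB : ∀ α, LexLT n.1 (A α) (B α) := by
    intro α
    refine ⟨(s α).length.1, (s α).length_lt, fun j hj => ?_, ?_⟩
    · rw [hAs α j hj, hBs α j hj]
    · rw [hA0 α, hB0 α]
      exact n.2.zero_mem_succ
  obtain ⟨X, hX, hX'⟩ := n.2.vFinite.funcs n.succ.succ.2.vFinite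
  obtain ⟨e, he, hround⟩ := hX.exists_rounded_embedding (LexLT n.1) (fun _ _ => LexLT.irrefl)
    (fun x y z _ _ hz => LexLT.trans n.2 hM ((hX' z).1 hz))
    (fun x y hx hy => LexLT.total n.2 hM ((hX' x).1 hx) ((hX' y).1 hy))
  have hAX : ∀ α, A α ∊ X := fun α => (hX' _).2 (hA α)
  have hBX : ∀ α, B α ∊ X := fun α => (hX' _).2 (hB α)
  have heA : StrictMono (fun α => e (A α)) := fun α β h => he _ _ (hAX α) (hAX β) (hAA α β h)
  have heB : StrictAnti (fun α => e (B α)) := fun α β h => he _ _ (hBX β) (hBX α) (hBB α β h)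
  refine ⟨hreg, hreg, fun α => e (A α), fun β => e (B β), ?_, ?_⟩
  · refine fun α α' β β' hα hβ => ⟨heA hα, ?_, heB hβ⟩
    calc e (A α') ≤ e (A (max α' β')) := heA.monotone (le_max_left _ _)
      _ < e (B (max α' β')) := he _ _ (hAX _) (hBX _) (hAB _)
      _ ≤ e (B β') := heB.antitone (le_max_right _ _)
  · rintro ⟨c, hc⟩
    obtain ⟨α₀⟩ : Nonempty κ.ord.ToType := Cardinal.nonempty_ord_toType hreg.ne_zero
    obtain ⟨x, hx, hxl, hxr⟩ := hround c ⟨A α₀, hAX _, (hc α₀ α₀).1.le⟩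
    have hxA : ∀ α, LexLT n.1 (A α) x := by
      intro α
      obtain ⟨β, hβ⟩ := exists_gt α
      rcases hxl _ (hAX β) (hc β β).1.le with h | h
      · exact h ▸ hAA α β hβ
      · exact (hAA α β hβ).trans n.2 hM ((hX' x).1 hx) h
    have hxB : ∀ α, LexLT n.1 x (B α) := fun α => hxr _ (hBX α) (hc α α).2
    -- `A α` and `B α` agree up to the length of `s α`. If `x` first exceeded `A α` before that
    -- length, it would exceed `B α` as well.
    have hxs : ∀ α i, i ∊ (s α).length.1 → app x i = adjoin (app (s α).1 i) (app (s α).1 i) := by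
      intro α
      obtain ⟨k, hk, hkj, hlt⟩ := hxA α
      have hle : (s α).length ≤ n.ofMem hk := by
        by_contra hk'
        rw [not_le] at hk'
        have hk'' : k ∊ (s α).length.1 := hk'
        refine LexLT.irrefl (LexLT.trans n.2 hM (hB α) ⟨k, hk, fun j hj => ?_, ?_⟩ (hxB α))
        · rw [← hkj j hj, hBs α j ((s α).length.2.trans hk'' hj),
            hAs α j ((s α).length.2.trans hk'' hj)]
        · rw [hBs α k hk'', ← hAs α k hk'']
          exact hlt
      intro i hi
      rw [← hkj i (Omega.mem_of_mem_of_le hi hle),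
        hAs α i hi]
    obtain ⟨σ, hσ, hσ'⟩ := exists_func n.1 n.succ.succ.1 (fun i => adjoin i i) fun i hi =>
      mem_adjoin.2 (.inl (n.2.succ_mem_succ hi))
    have hσi : InjOn σ n.1 := by
      intro i j hi hj h
      rw [hσ' i hi, hσ' j hj] at h
      by_contra hij
      have h1 : i ∊ adjoin j j := h ▸ mem_adjoin.2 (.inr rfl)
      have h2 : j ∊ adjoin i i := h ▸ mem_adjoin.2 (.inr rfl)
      rcases mem_adjoin.1 h1 with h1 | h1
      · rcases mem_adjoin.1 h2 with h2 | h2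
        · exact notMem_self _ ((n.2.mem hj).trans h1 h2)
        · exact hij h2.symm
      · exact hij h1
    -- A left inverse of the successor map undoes the shift.
    obtain ⟨π, hπ, hπσ⟩ := hσ.exists_leftInverse hσi hn0
    -- Elements of the tree have length below `n = p + 1`, so `x` is restricted to `p`; this still
    -- covers every `s α`.
    obtain ⟨p, rfl⟩ := n.eq_bot_or_succ.resolve_left fun h => notMem_zero _ (h ▸ hn0)
    obtain ⟨r, hr, hr'⟩ := exists_func p.1 p.succ.1 (fun i => app π (app x i)) fun i hi =>
      hπ.app_mem (((hX' x).1 hx).app_mem (p.succ.2.trans p.lt_succ hi))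
    refine hub ⟨⟨r, p.1, p.lt_succ, hr⟩, ?_⟩
    rintro _ ⟨α, rfl⟩
    have hle : (s α).length ≤ p := Omega.lt_succ_iff.1 (s α).length_lt
    refine ((s α).isFunc.subset_iff hr).2 fun i hi => ?_
    have hip : i ∊ p.1 := Omega.mem_of_mem_of_le hi hle
    have hsi := (s α).isFunc.app_mem hi
    exact ⟨hip, by rw [hr' i hip, hxs α i hi, ← hσ' _ hsi, hπσ _ hsi]⟩

end Lexicographic

end ZFCMinus

namespace ZFCMinus

/-! ### Well-founded recursion with choices -/

/-- Each condition depends only on earlier values, so one may choose a solution at every stage, with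
a dummy value in place of the later ones. -/
theorem exists_wellFounded_recursion {I X : Type*} [Nonempty X] [LinearOrder I] [WellFoundedLT I]
    (P : I → (I → X) → X → Prop)
    (hcongr : ∀ μ S S' s, (∀ α < μ, S α = S' α) → P μ S s → P μ S' s)
    (hstep : ∀ μ S, (∀ α < μ, P α S (S α)) → ∃ s, P μ S s) :
    ∃ S : I → X, ∀ μ, P μ S (S μ) := by
  classical
  let x₀ : X := Classical.arbitrary X
  let F : (μ : I) → ((α : I) → α < μ → X) → X := fun μ rec =>
    Classical.epsilon (P μ fun α => if h : α < μ then rec α h else x₀)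
  have hwf : WellFounded ((· < ·) : I → I → Prop) := wellFounded_lt
  let S : I → X := hwf.fix F
  refine ⟨S, fun μ => ?_⟩
  induction μ using hwf.induction with
  | _ μ ih =>
    have hS : S μ = Classical.epsilon (P μ fun α => if α < μ then S α else x₀) := by
      change hwf.fix F μ = _
      rw [hwf.fix_eq]
      rfl
    have hlt : ∀ α < μ, S α = (fun α => if α < μ then S α else x₀) α := fun α h => by simp [h]
    obtain ⟨s, hs⟩ := hstep μ S ih
    rw [hS]
    exact hcongr _ _ _ _ (fun α h => (hlt α h).symm)
      (Classical.epsilon_spec (p := P μ fun α => if α < μ then S α else x₀)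
        ⟨s, hcongr _ _ _ _ hlt hs⟩)

/-! ### Recursion, symmetric cuts and compactness under bounded trees -/

section Bounded

variable {V : Type u} [setLang.Structure V]

variable (V) in
/-- In the trees `n^{<n}` of `V`, every increasing sequence has an upper bound. -/
def TreesBounded : Prop :=
  ∀ n : Omega V, (∃ m : Omega V, m < n) → ∀ (κ : Cardinal.{u}) (s : κ.ord.ToType → SeqTree n),
    StrictMono s → BddAbove (Set.range s)

variable [hV : Fact (ModelsZFCMinus V)]

/-- If the trees of `V` are bounded, then so are the trees of sequences in a finite set. -/
theorem TreesBounded.exists_bound (hT : TreesBounded V) {W : V} (hW : VFinite W) {ι : Type u}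
    [LinearOrder ι] [Nonempty ι] {a : ι → Omega V} (ha : StrictMono a) {N : Omega V}
    (hN : ∀ i, a i ≤ N) {s : ι → V} (hs : ∀ i, IsFunc (s i) (a i).1 W)
    (hco : ∀ i j, i < j → ∀ x, x ∊ (a i).1 → app (s j) x = app (s i) x) :
    ∃ (r : V) (l : Omega V), IsFunc r l.1 W ∧
      ∀ i, a i ≤ l ∧ ∀ x, x ∊ (a i).1 → app r x = app (s i) x := by
  by_cases hmax : ∃ i : ι, ∀ j, j ≤ i
  · obtain ⟨i, hi⟩ := hmax
    refine ⟨s i, a i, hs i, fun j => ⟨ha.monotone (hi j), fun x hx => ?_⟩⟩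
    rcases (hi j).eq_or_lt with rfl | h
    exacts [rfl, hco j i h x hx]
  push Not at hmax
  have : NoMaxOrder ι := ⟨hmax⟩
  obtain ⟨κ, -, -, f, hf, hcof⟩ := exists_strictMono_cofinal ι
  obtain ⟨n₀, j, hn₀, hj, hji⟩ := hW
  -- Large enough for the lengths, which are at most `N`, and for the codes of the elements of `W`.
  let n : Omega V := max ⟨n₀, hn₀⟩ N.succ
  have hNn : N < n := lt_of_lt_of_le N.lt_succ (le_max_right _ _)
  have hj' : IsFunc j W n.1 := hj.codomain fun x hx =>
    Omega.mem_of_mem_of_le (m := ⟨n₀, hn₀⟩) (hj.app_mem hx) (le_max_left _ _)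
  have hσ : ∀ i, ∃ σ : V, IsFunc σ (a i).1 n.1 ∧
      ∀ x, x ∊ (a i).1 → app σ x = app j (app (s i) x) := fun i =>
    exists_func (a i).1 n.1 (fun x => app j (app (s i) x)) fun x hx =>
      hj'.app_mem ((hs i).app_mem hx)
  choose σ hσf hσ using hσ
  let T : κ.ord.ToType → SeqTree n := fun k =>
    ⟨σ (f k), (a (f k)).1, lt_of_le_of_lt (hN (f k)) hNn, hσf (f k)⟩
  have hTmono : StrictMono T := by
    intro k k' hk
    have h1 : a (f k) < a (f k') := ha (hf hk)
    refine ⟨((hσf _).subset_iff (hσf _)).2 fun x hx => ?_, fun h => ?_⟩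
    · have hx' : x ∊ (a (f k')).1 := (a (f k')).2.trans h1 hx
      exact ⟨hx', by rw [hσ _ x hx, hσ _ x hx', hco _ _ (hf hk) x hx]⟩
    · exact h1.not_ge (Omega.le_of_subset fun x hx =>
        (((hσf _).subset_iff (hσf _)).1 h x hx).1)
  obtain ⟨t, ht⟩ := hT n ⟨N, hNn⟩ κ T hTmono
  obtain ⟨i₀⟩ := ‹Nonempty ι›
  -- Decoding needs some element of `W`: as `a i₀ < a i₁`, the value of `s i₁` at `a i₀` serves.
  obtain ⟨i₁, hi₁⟩ := exists_gt i₀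
  obtain ⟨g, hg, hgj⟩ := hj'.exists_leftInverse hji ((hs i₁).app_mem (ha hi₁))
  obtain ⟨r, hr, hr'⟩ := exists_func t.length.1 W (fun x => app g (app t.1 x)) fun x hx =>
    hg.app_mem (t.isFunc.app_mem hx)
  refine ⟨r, t.length, hr, fun i => ?_⟩
  obtain ⟨k, hk⟩ := hcof i
  have h1 := ((hσf (f k)).subset_iff t.isFunc).1 (ht ⟨k, rfl⟩)
  have h2 : a i ≤ a (f k) := ha.monotone hk
  have h3 : ∀ x, x ∊ (a i).1 → x ∊ (a (f k)).1 := fun x hx =>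
    Omega.mem_of_mem_of_le hx h2
  refine ⟨h2.trans (Omega.le_of_subset fun x hx => (h1 x hx).1), fun x hx => ?_⟩
  obtain ⟨h4, h5⟩ := h1 x (h3 x hx)
  rw [hr' x h4, h5, hσ _ x (h3 x hx), hgj _ ((hs _).app_mem (h3 x hx))]
  rcases hk.eq_or_lt with rfl | h
  exacts [rfl, hco _ _ h x hx]

/-- Recursive construction of a sequence in a finite set, of which an initial segment is
determined at each stage. -/
theorem TreesBounded.exists_recursion (hT : TreesBounded V) {W : V} (hW : VFinite W) {I : Type u}
    [LinearOrder I] [WellFoundedLT I] [Nonempty I] {a : I → Omega V} (ha : StrictMono a)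
    {N : Omega V} (hN : ∀ i, a i < N) (Q : I → V → Prop)
    (hQ : ∀ μ r r', (∀ x, x ∊ (a μ).succ.1 → app r x = app r' x) → Q μ r → Q μ r')
    (hstep : ∀ μ r (l : Omega V), IsFunc r l.1 W → (∀ α < μ, a α < l ∧ Q α r) →
      ∃ s, IsFunc s (a μ).succ.1 W ∧
        (∀ α < μ, ∀ x, x ∊ (a α).succ.1 → app s x = app r x) ∧ Q μ s) :
    ∃ (r : V) (l : Omega V), IsFunc r l.1 W ∧ ∀ α, a α < l ∧ Q α r := by
  let P : I → (I → V) → V → Prop := fun μ S s => IsFunc s (a μ).succ.1 W ∧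
    (∀ α < μ, ∀ x, x ∊ (a α).succ.1 → app s x = app (S α) x) ∧ Q μ s
  have hbound : ∀ (D : Set I) (S : I → V), D.Nonempty → (∀ α ∈ D, P α S (S α)) →
      ∃ (r : V) (l : Omega V), IsFunc r l.1 W ∧
        ∀ α ∈ D, a α < l ∧ ∀ x, x ∊ (a α).succ.1 → app r x = app (S α) x := by
    intro D S hD hP
    have : Nonempty D := hD.to_subtype
    have hsucc : StrictMono fun i : D => (a i.1).succ := fun i j hij =>
      Omega.lt_succ_iff.2 (Omega.succ_le_iff.2 (ha hij))
    obtain ⟨r, l, hr, hl⟩ := hT.exists_bound hW hsucc (N := N)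
      (fun i => Omega.succ_le_iff.2 (hN i.1)) (s := fun i : D => S i.1)
      (fun i => (hP i.1 i.2).1) (fun i j hij => (hP j.1 j.2).2.1 i.1 hij)
    exact ⟨r, l, hr, fun α hα => ⟨Omega.succ_le_iff.1 (hl ⟨α, hα⟩).1, (hl ⟨α, hα⟩).2⟩⟩
  have : Nonempty V := ⟨zero V⟩
  obtain ⟨S, hS⟩ := exists_wellFounded_recursion P
    (by
      rintro μ S S' s h ⟨h1, h2, h3⟩
      exact ⟨h1, fun α hα x hx => h α hα ▸ h2 α hα x hx, h3⟩)
    (by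
      intro μ S hS
      have : ∃ (r : V) (l : Omega V), IsFunc r l.1 W ∧
          ∀ α < μ, a α < l ∧ ∀ x, x ∊ (a α).succ.1 → app r x = app (S α) x := by
        -- At the first stage there is nothing to bound, and the empty function is used.
        by_cases hμ : (Set.Iio μ).Nonempty
        · exact hbound (Set.Iio μ) S hμ hS
        · obtain ⟨r, hr, -⟩ := exists_func (zero V) W (fun x => x) fun x hx =>
            (notMem_zero x hx).elim
          exact ⟨r, ⊥, hr, fun α hα => (hμ ⟨α, hα⟩).elim⟩
      obtain ⟨r, l, hr, hl⟩ := this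
      obtain ⟨s, hs, hs', hQs⟩ := hstep μ r l hr fun α hα => ⟨(hl α hα).1,
        hQ α _ _ (fun x hx => ((hl α hα).2 x hx).symm) (hS α hα).2.2⟩
      exact ⟨s, hs, fun α hα x hx => (hs' α hα x hx).trans ((hl α hα).2 x hx), hQs⟩)
  obtain ⟨r, l, hr, hl⟩ := hbound Set.univ S Set.univ_nonempty fun α _ => hS α
  exact ⟨r, l, hr, fun α => ⟨(hl α trivial).1,
    hQ α _ _ (fun x hx => ((hl α trivial).2 x hx).symm) (hS α).2.2⟩⟩

/-- This is overspill: a definable property that holds on `[a, y]` for cofinally many `y` of a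
sequence holds up to some `e` above the whole sequence. Reaching `l`, the end of the domain, counts
as failure, so a failure always exists. -/
theorem Omega.exists_least_failure (P : V → Prop)
    [hP : DefinablePred (fun v : Fin 1 → V => P (v 0))] (a l : Omega V) :
    ∃ e : Omega V, (∀ x : Omega V, a ≤ x → x < e → x < l ∧ P x.1) ∧
      ∀ y : Omega V, (∀ x : Omega V, a ≤ x → x ≤ y → x < l ∧ P x.1) → y < e := by
  obtain ⟨e, ⟨he1, he2⟩, hmin⟩ := Omega.exists_least
    (fun e => ¬ e ∊ a.1 ∧ ¬ (e ∊ l.1 ∧ P e)) (n := max a l)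
    ⟨fun h => (le_max_left a l).not_gt h, fun h => (le_max_right a l).not_gt h.1⟩
  refine ⟨e, fun x hax hxe => ?_, fun y hy => ?_⟩
  · by_contra h
    exact hmin x hxe ⟨fun h' => hax.not_gt h', h⟩
  · by_contra h
    exact he2 (hy e (not_lt.1 he1) (not_lt.1 h))

open Classical in
/-- Bounded trees leave no cuts with two sides of the same length. -/
theorem TreesBounded.exists_between_of_antitone (hT : TreesBounded V) {I : Type u} [LinearOrder I]
    [WellFoundedLT I] [Nonempty I] {a b : I → Omega V} (ha : StrictMono a)
    (hb : Antitone b) {N : Omega V} (hN : ∀ i, b i < N) (hab : ∀ i j, a i < b j) :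
    ∃ c, (∀ i, a i ≤ c) ∧ ∀ i, c ≤ b i := by
  -- The sequence `r` is nonincreasing and at least `b μ` on `[0, a μ]`, with the value `b μ` at `a
  -- μ`.
  obtain ⟨r, l, hr, hrl⟩ := hT.exists_recursion N.2.vFinite ha (N := N)
    (fun i => (hab i i).trans (hN i))
    (fun μ r => (∀ x, x ∊ (a μ).succ.1 → ¬ app r x ∊ (b μ).1 ∧ ∀ y, y ∊ x → ¬ app r y ∊ app r x) ∧
      app r (a μ).1 = (b μ).1)
    (by
      rintro μ r r' h ⟨h1, h2⟩
      refine ⟨fun x hx => ⟨?_, fun y hy => ?_⟩, ?_⟩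
      · rw [← h x hx]
        exact (h1 x hx).1
      · rw [← h x hx, ← h y ((a μ).succ.2.trans hx hy)]
        exact (h1 x hx).2 y hy
      · rw [← h _ (a μ).lt_succ, h2])
    (by
      intro μ r l hr h
      obtain ⟨e, he1, he2⟩ := Omega.exists_least_failure
        (fun x => ¬ app r x ∊ (b μ).1 ∧ ∀ y, y ∊ x → ¬ app r y ∊ app r x) ⊥ l
      have hα : ∀ α < μ, a α < e := by
        intro α hα
        refine he2 _ fun x _ hx => ⟨hx.trans_lt (h α hα).1, fun hlt => ?_, ?_⟩
        · have h1 := ((h α hα).2.1 x.1 (Omega.lt_succ_iff.2 hx)).1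
          exact h1 (Omega.mem_of_mem_of_le hlt (hb hα.le))
        · exact ((h α hα).2.1 x.1 (Omega.lt_succ_iff.2 hx)).2
      -- Below `c` the bound `r` is still good; from `c` to `a μ` the new sequence is constantly `b
      -- μ`. As `c` is above all earlier `a α`, nothing already fixed is altered.
      set c := min e (a μ) with hc
      have hcx : ∀ x, x ∊ c.1 → x ∊ l.1 ∧ ¬ app r x ∊ (b μ).1 ∧
          ∀ y, y ∊ x → ¬ app r y ∊ app r x := fun x hx =>
        he1 (c.ofMem hx) bot_le (Omega.mem_of_mem_of_le hx (min_le_left _ _))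
      obtain ⟨s, hs, hs'⟩ := exists_func (a μ).succ.1 N.1
        (fun x => if x ∊ c.1 then app r x else (b μ).1) (by
          intro x _
          split_ifs with hx
          · exact hr.app_mem (hcx x hx).1
          · exact hN μ)
      refine ⟨s, hs, fun α hα' x hx => ?_, fun x hx => ⟨?_, fun y hy => ?_⟩, ?_⟩
      · have h1 : (a α).succ ≤ c := le_min (Omega.succ_le_iff.2 (hα α hα'))
          (Omega.succ_le_iff.2 (ha hα'))
        have hxc : x ∊ c.1 := Omega.mem_of_mem_of_le hx h1
        have hxμ : x ∊ (a μ).succ.1 := Omega.mem_of_mem_of_le hxc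
          ((min_le_right _ _).trans (a μ).lt_succ.le)
        rw [hs' x hxμ, if_pos hxc]
      · rw [hs' x hx]
        split_ifs with hxc
        exacts [(hcx x hxc).2.1, notMem_self _]
      · rw [hs' x hx, hs' y ((a μ).succ.2.trans hx hy)]
        by_cases hxc : x ∊ c.1
        · rw [if_pos hxc, if_pos (c.2.trans hxc hy)]
          exact (hcx x hxc).2.2 y hy
        · rw [if_neg hxc]
          split_ifs with hyc
          exacts [(hcx y hyc).2.1, notMem_self _]
      · exact (hs' _ (a μ).lt_succ).trans (if_neg (min_le_right e (a μ)).not_gt))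
  -- The cut is filled by the first failure of `x < r x` or of monotonicity. If `b β < e`, then `b β
  -- < r (b β) ≤ r (a β) = b β`.
  obtain ⟨e, he1, he2⟩ := Omega.exists_least_failure
    (fun x => x ∊ app r x ∧ ∀ y, y ∊ x → ¬ app r y ∊ app r x) ⊥ l
  refine ⟨e, fun α => (he2 _ fun x _ hx => ?_).le, fun β => ?_⟩
  · have hxl : x < l := hx.trans_lt (hrl α).1
    obtain ⟨h1, h2⟩ := (hrl α).2.1 x.1 (Omega.lt_succ_iff.2 hx)
    refine ⟨hxl, ?_, h2⟩
    let y : Omega V := N.ofMem (hr.app_mem hxl)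
    have h3 : b α ≤ y := not_lt.1 h1
    exact hx.trans_lt ((hab α α).trans_le h3)
  · by_contra hlt
    rw [not_le] at hlt
    obtain ⟨-, h1, h2⟩ := he1 (b β) bot_le hlt
    refine h2 _ (hab β β) ?_
    rw [(hrl β).2.2]
    exact h1

variable (V) in
/-- Between two sets of at most `ν` natural numbers of `V`, one below the other one, there is a
natural number. -/
def Fills (ν : Cardinal.{u}) : Prop :=
  ∀ (J K : Type u) (a : J → Omega V) (b : K → Omega V), #J ≤ ν → #K ≤ ν → Nonempty K →
    (∀ j k, a j ≤ b k) → ∃ c, (∀ j, a j ≤ c) ∧ ∀ k, c ≤ b k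

theorem mk_Iio_toType_lt {κ : Cardinal.{u}} (i : κ.ord.ToType) : #(Set.Iio i) < κ := by
  simpa using Cardinal.mk_Iio_lt i (by simp)

theorem mk_Iic_lt {I : Type u} [LinearOrder I] [WellFoundedLT I] [NoMaxOrder I]
    (h : ∀ i : I, #(Set.Iio i) < #I) (i : I) : #(Set.Iic i) < #I := by
  obtain ⟨j, hj⟩ := exists_gt i
  exact (Cardinal.mk_le_mk_of_subset fun k hk => lt_of_le_of_lt hk hj).trans_lt (h j)

open Classical in
/-- Small families of subsets of a finite set of `V` with the finite intersection property have a
common element. -/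
theorem TreesBounded.exists_mem_forall (hT : TreesBounded V) {ν : Cardinal.{u}}
    (hF : ∀ μ < ν, Fills V μ) {a : ν.ord.ToType → Omega V} (ha : StrictMono a) {N : Omega V}
    (hN : ∀ i, a i < N) {W : V} (hW : VFinite W) {J : Type u} (hJ : #J < ν) (C : J → V)
    (hC : ∀ t : Finset J, ∃ w, w ∊ W ∧ ∀ j ∈ t, w ∊ C j) : ∃ w, w ∊ W ∧ ∀ j, w ∊ C j := by
  induction hcard : #J using WellFoundedLT.induction generalizing J with
  | ind μ ih =>
  subst hcard
  rcases finite_or_infinite J with hfin | hinf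
  · have := Fintype.ofFinite J
    obtain ⟨w, hw, h⟩ := hC Finset.univ
    exact ⟨w, hw, fun j => h j (Finset.mem_univ j)⟩
  have hinf' : ℵ₀ ≤ #J := Cardinal.aleph0_le_mk J
  set I := (#J).ord.ToType with hI
  have hIJ : #I = #J := Cardinal.mk_ord_toType _
  obtain ⟨φ⟩ := Cardinal.eq.1 hIJ
  have : NoMaxOrder I := Cardinal.noMaxOrder hinf'
  have : Nonempty I := φ.nonempty
  have hIio : ∀ i : I, #(Set.Iio i) < #I := fun i =>
    (mk_Iio_toType_lt i).trans_eq hIJ.symm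
  obtain ⟨ι⟩ : Nonempty (InitialSeg ((· < ·) : I → I → Prop)
      ((· < ·) : ν.ord.ToType → ν.ord.ToType → Prop)) :=
    Ordinal.type_le_iff.1 (by
      rw [Ordinal.type_toType, Ordinal.type_toType]
      exact Cardinal.ord_le_ord.2 hJ.le)
  have hι : StrictMono ι := fun i j h => ι.map_rel_iff.2 h
  have ha' : StrictMono (a ∘ ι) := ha.comp hι
  have hw : ∀ μ : I, ∃ w, w ∊ W ∧ ∀ β ≤ μ, w ∊ C (φ β) := by
    intro μ
    have hlt : #(Set.Iic μ) < #J := (mk_Iic_lt hIio μ).trans_eq hIJ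
    obtain ⟨w, hw, h⟩ := ih _ hlt (hlt.trans hJ) (fun β : Set.Iic μ => C (φ β.1)) (fun t => by
      obtain ⟨w, hw, h⟩ := hC (t.image fun β => φ β.1)
      exact ⟨w, hw, fun j hj => h _ (Finset.mem_image_of_mem _ hj)⟩) rfl
    -- Proper initial segments of the family are smaller than `J`, so by induction they have common
    -- elements `w μ`.
    exact ⟨w, hw, fun β hβ => h ⟨β, hβ⟩⟩
  choose w hwW hwC using hw
  -- The values of `r` enter `C (φ β)` at `a (ι β)` and stay there.
  obtain ⟨r, l, hr, hrl⟩ := hT.exists_recursion hW ha' (N := N) (fun i => hN _)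
    (fun μ r => ∀ β ≤ μ, ∀ x, x ∊ (a (ι μ)).succ.1 → ¬ x ∊ (a (ι β)).1 → app r x ∊ C (φ β))
    (by
      intro μ r r' h h1 β hβ x hx hxβ
      rw [← h x hx]
      exact h1 β hβ x hx hxβ)
    (by
      intro μ r l hr h
      choose e he1 he2 using fun β : I =>
        Omega.exists_least_failure (fun x => app r x ∊ C (φ β)) (a (ι β)) l
      have hlt : #(Option (Set.Iio μ)) < ν := by
        rw [Cardinal.mk_option]
        exact (Cardinal.add_lt_of_lt hinf' ((hIio μ).trans_eq hIJ)
          (Cardinal.one_lt_aleph0.trans_le hinf')).trans hJ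
      -- The family has fewer than `ν` sets, so some `c` lies above the earlier stages and below all
      -- first failures. The index `none` adds the bounds `a (ι μ)` and `l`. From `c` on, `r` is
      -- replaced by `w μ`.
      obtain ⟨c, hc1, hc2⟩ := hF _ hlt (Set.Iio μ) (Option (Set.Iio μ))
        (fun α => (a (ι α.1)).succ) (fun k => k.elim (min (a (ι μ)) l) fun β => e β.1)
        (by rw [Cardinal.mk_option]; exact self_le_add_right _ _) le_rfl ⟨none⟩ (by
          rintro ⟨α, hα⟩ (_ | ⟨β, hβ⟩)
          · exact le_min (Omega.succ_le_iff.2 (ha' hα)) (Omega.succ_le_iff.2 (h α hα).1)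
          · refine Omega.succ_le_iff.2 (he2 β _ fun x hβx hxα => ⟨hxα.trans_lt (h α hα).1, ?_⟩)
            exact (h α hα).2 β (ha'.le_iff_le.1 (hβx.trans hxα)) _ (Omega.lt_succ_iff.2 hxα)
              hβx.not_gt)
      have hcμ : c ≤ a (ι μ) := (hc2 none).trans (min_le_left _ _)
      have hcl : c ≤ l := (hc2 none).trans (min_le_right _ _)
      obtain ⟨s, hs, hs'⟩ := exists_func (a (ι μ)).succ.1 W
        (fun x => if x ∊ c.1 then app r x else w μ) (by
          intro x _
          split_ifs with hx
          · exact hr.app_mem (Omega.mem_of_mem_of_le hx hcl)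
          · exact hwW μ)
      refine ⟨s, hs, fun α hα x hx => ?_, fun β hβ x hx hxβ => ?_⟩
      · have hxc : x ∊ c.1 :=
          Omega.mem_of_mem_of_le hx (hc1 ⟨α, hα⟩)
        rw [hs' x (Omega.mem_of_mem_of_le hxc
          (hcμ.trans (Omega.lt_succ _).le)), if_pos hxc]
      · rw [hs' x hx]
        split_ifs with hxc
        · rcases hβ.eq_or_lt with rfl | hβ
          · exact (hxβ (Omega.mem_of_mem_of_le hxc hcμ)).elim
          · exact (he1 β (c.ofMem hxc) (not_lt.1 hxβ)
              (Omega.mem_of_mem_of_le hxc (hc2 (some ⟨β, hβ⟩)))).2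
        · exact hwC μ β hβ)
  choose e he1 he2 using fun β : I =>
    Omega.exists_least_failure (fun x => app r x ∊ C (φ β)) (a (ι β)) l
  obtain ⟨c, hc1, hc2⟩ := hF _ hJ I I (fun α => (a (ι α)).succ) e hIJ.le hIJ.le inferInstance
    (by
      intro α β
      refine Omega.succ_le_iff.2 (he2 β _ fun x hβx hxα => ⟨hxα.trans_lt (hrl α).1, ?_⟩)
      exact (hrl α).2 β (ha'.le_iff_le.1 (hβx.trans hxα)) _ (Omega.lt_succ_iff.2 hxα)
        hβx.not_gt)
  obtain ⟨α₀⟩ := ‹Nonempty I›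
  -- Failures are strict upper ends, so the common element is read off at the predecessor of `c`.
  obtain ⟨d, rfl⟩ := c.eq_bot_or_succ.resolve_left fun h => notMem_zero (a (ι α₀)).1
    (Omega.succ_le_iff.1 (h ▸ hc1 α₀))
  have hd : ∀ β, d < l ∧ app r d.1 ∊ C (φ β) := fun β =>
    he1 β d (Omega.lt_succ_iff.1 (Omega.succ_le_iff.1 (hc1 β))) (Omega.succ_le_iff.1 (hc2 β))
  refine ⟨app r d.1, hr.app_mem (hd α₀).1, fun j => ?_⟩
  simpa using (hd (φ.symm j)).2

end Bounded

end ZFCMinus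

/-! ### Cuts with sides of different lengths -/

namespace ZFCMinus

theorem mk_le_of_forall_mk_Iio_lt {L : Type u} [LinearOrder L] [WellFoundedLT L]
    {κ : Cardinal.{u}} (h : ∀ x : L, #(Set.Iio x) < κ) : #L ≤ κ := by
  by_contra hlt
  rw [not_le] at hlt
  have hord : κ.ord < Ordinal.type ((· < ·) : L → L → Prop) := by
    rw [← not_le]
    intro hle
    have := Ordinal.card_le_card hle
    rw [Cardinal.card_ord, Ordinal.card_type] at this
    exact this.not_gt hlt
  obtain ⟨x, hx⟩ := Ordinal.typein_surj _ hord
  have h1 := congrArg Ordinal.card hx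
  rw [Cardinal.card_ord] at h1
  exact (h x).ne h1

/-- Either every initial segment is small and the set is all of `I`, or it contains the initial
segment below the first point with more than `κ` predecessors. -/
theorem lt_mk_setOf_mk_Iio_le {I : Type u} [LinearOrder I] [WellFoundedLT I] {κ : Cardinal.{u}}
    (h : κ < #I) : κ < #{β : I | #(Set.Iio β) ≤ κ} := by
  by_contra hle
  rw [not_lt] at hle
  by_cases hall : ∀ β : I, #(Set.Iio β) ≤ κ
  · have : {β : I | #(Set.Iio β) ≤ κ} = Set.univ := Set.eq_univ_of_forall hall
    rw [this, Cardinal.mk_univ] at hle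
    exact hle.not_gt h
  · push Not at hall
    obtain ⟨μ, hμ, hmin⟩ := wellFounded_lt.has_min {β : I | κ < #(Set.Iio β)} hall
    have hsub : Set.Iio μ ⊆ {β : I | #(Set.Iio β) ≤ κ} := fun β hβ => by
      by_contra h
      exact hmin β (show κ < #(Set.Iio β) from not_le.1 h) hβ
    exact (hμ.trans_le (Cardinal.mk_le_mk_of_subset hsub)).not_ge hle

section Asymmetric

variable {V : Type u} [setLang.Structure V] [hV : Fact (ModelsZFCMinus V)]

/-- An externally finite set of prescribed values is realised inside `V`, with support at the
prescribed points only. It supplies the finite intersection property for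
`TreesBounded.exists_mem_forall`. -/
theorem exists_func_of_finset {I : Type*} {a v : I → Omega V} (ha : Function.Injective a)
    {N : Omega V} (hN : ∀ i, v i < N) (hN0 : zero V ∊ N.1) (T : Finset I) :
    ∃ w : V, IsFunc w N.1 N.1 ∧ (∀ β ∈ T, a β < N → app w (a β).1 = (v β).1) ∧
      ∀ p, p ∊ N.1 → app w p ≠ zero V → ∃ β ∈ T, p = (a β).1 ∧ app w p = (v β).1 := by
  classical
  induction T using Finset.induction_on with
  | empty =>
    obtain ⟨w, hw, hw'⟩ := exists_func N.1 N.1 (fun _ => zero V) fun _ _ => hN0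
    exact ⟨w, hw, by simp, fun p hp h => (h (hw' p hp)).elim⟩
  | insert β T hβ ih =>
    obtain ⟨w, hw, hw1, hw2⟩ := ih
    obtain ⟨w', hw', h⟩ := exists_func N.1 N.1 (fun p => if p = (a β).1 then (v β).1 else app w p)
      (by
        intro p hp
        split_ifs
        exacts [hN β, hw.app_mem hp])
    refine ⟨w', hw', fun α hα hαN => ?_, fun p hp hne => ?_⟩
    · rw [h _ hαN]
      rcases Finset.mem_insert.1 hα with rfl | hα
      · rw [if_pos rfl]
      · rw [if_neg fun e => hβ ((ha (Subtype.ext e) : α = β) ▸ hα), hw1 α hα hαN]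
    · rw [h p hp] at hne ⊢
      split_ifs at hne ⊢ with hpβ
      · exact ⟨β, Finset.mem_insert_self _ _, hpβ, rfl⟩
      · obtain ⟨α, hα, h⟩ := hw2 p hp hne
        exact ⟨α, Finset.mem_insert_of_mem hα, h⟩

/-- In the sequence `r` of functions, with the support of `r x` being the set of points which are
alive at `x`, any two points `p < q ≤ x` that are alive at `x` satisfy `r q p ≥ x`. -/
def Spread (r x : V) : Prop :=
  ∀ p q, q ∊ adjoin x x → p ∊ q → app (app r x) p ≠ zero V → app (app r x) q ≠ zero V →
    ¬ app (app r q) p ∊ x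

theorem definablePred_spread : DefinablePred (fun v : Fin 2 → V => Spread (v 0) (v 1)) := by
  unfold Spread; infer_instance

instance {α : Type} {t t' : (α → V) → V} [DefinableFn t] [DefinableFn t'] :
    DefinablePred (fun v => Spread (t v) (t' v)) :=
  definablePred_spread.comp₂

theorem Spread.congr {r r' : V} {x : Omega V} (h : ∀ q, q ∊ x.succ.1 → app r q = app r' q)
    (hr : Spread r x.1) : Spread r' x.1 := by
  intro p q hq hp
  rw [← h q hq, ← h x.1 x.lt_succ]
  exact hr p q hq hp

open Classical in
/-- Bounded trees leave no cuts with a longer lower side of least possible length. -/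
theorem TreesBounded.exists_between_of_lt (hT : TreesBounded V) {ν κ : Cardinal.{u}}
    (hκ : ℵ₀ ≤ κ) (hκν : κ < ν) (hF : ∀ μ < ν, Fills V μ) {a : ν.ord.ToType → Omega V}
    (ha : StrictMono a) {b : κ.ord.ToType → Omega V} (hb : StrictAnti b) (hab : ∀ i j, a i < b j) :
    ∃ c, (∀ i, a i ≤ c) ∧ ∀ j, c ≤ b j := by
  by_contra hno
  have hν : ℵ₀ ≤ ν := hκ.trans hκν.le
  have hIν : #ν.ord.ToType = ν := Cardinal.mk_ord_toType ν
  have : NoMaxOrder ν.ord.ToType := Cardinal.noMaxOrder hν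
  have : Nonempty ν.ord.ToType := Cardinal.nonempty_ord_toType (Cardinal.aleph0_pos.trans_le hν).ne'
  have : Nonempty κ.ord.ToType :=
    Cardinal.nonempty_ord_toType (Cardinal.aleph0_pos.trans_le hκ).ne'
  have hIic : ∀ i : ν.ord.ToType, #(Set.Iic i) < ν := fun i =>
    (mk_Iic_lt (fun i => (mk_Iio_toType_lt i).trans_eq hIν.symm) i).trans_eq hIν
  obtain ⟨N, hbN⟩ : ∃ N : Omega V, ∀ j, b j < N := by
    obtain ⟨j, -, hj⟩ := wellFounded_lt.has_min (Set.univ : Set κ.ord.ToType) Set.univ_nonempty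
    exact ⟨(b j).succ, fun i => Omega.lt_succ_iff.2 (hb.antitone (not_lt.1 (hj i trivial)))⟩
  obtain ⟨j₀⟩ := ‹Nonempty κ.ord.ToType›
  have haN : ∀ i, a i < N := fun i => (hab i j₀).trans (hbN j₀)
  have hN0 : zero V ∊ N.1 := lt_of_le_of_lt (bot_le (a := b j₀)) (hbN j₀)
  have hb0 : ∀ j, (b j).1 ≠ zero V := by
    intro j h
    obtain ⟨i⟩ := ‹Nonempty ν.ord.ToType›
    exact notMem_zero (a i).1 (h ▸ hab i j)
  -- `J` is an initial segment with more than `κ` elements, each having at most `κ` predecessors; so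
  -- `γ μ` can label these injectively by indices of the upper side.
  let J : Set ν.ord.ToType := {β | #(Set.Iio β) ≤ κ}
  have hJκ : κ < #J := lt_mk_setOf_mk_Iio_le (hIν.symm ▸ hκν)
  have hJlower : ∀ α β, α < β → β ∈ J → α ∈ J := fun α β h hβ =>
    (Cardinal.mk_le_mk_of_subset (Set.Iio_subset_Iio h.le)).trans hβ
  have hγ : ∀ μ : ν.ord.ToType, ∃ g : ν.ord.ToType → κ.ord.ToType, μ ∈ J → Set.InjOn g (Set.Iio μ) := by
    intro μ
    by_cases hμ : μ ∈ J
    · have : #(Set.Iio μ) ≤ #κ.ord.ToType := by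
        rw [Cardinal.mk_ord_toType]; exact hμ
      obtain ⟨φ⟩ := this
      refine ⟨fun β => if h : β < μ then φ ⟨β, h⟩ else j₀, fun _ β hβ β' hβ' h => ?_⟩
      have hβ₁ : β < μ := hβ
      have hβ₁' : β' < μ := hβ'
      simp only [hβ₁, hβ₁', dif_pos] at h
      exact congrArg Subtype.val (φ.injective h)
    · exact ⟨fun _ => j₀, fun h => (hμ h).elim⟩
  choose γ hγ using hγ
  obtain ⟨W, hW, hW'⟩ := N.2.vFinite.funcs N.2.vFinite
  -- Up to `a μ`, `r` is spread, every `a β` with `β ∈ J` stays alive from its own place on, and `r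
  -- (a μ)` records the labels of the predecessors of `μ`.
  obtain ⟨r, l, hr, hrl⟩ := hT.exists_recursion hW ha (N := N) haN
    (fun μ r => (∀ x : Omega V, x ≤ a μ → Spread r x.1) ∧
      (∀ β ≤ μ, ∀ x : Omega V, a β ≤ x → x ≤ a μ → β ∈ J → app (app r x.1) (a β).1 ≠ zero V) ∧
      (μ ∈ J → ∀ β < μ, app (app r (a μ).1) (a β).1 = (b (γ μ β)).1))
    (by
      rintro μ r r' h ⟨h1, h2, h3⟩
      refine ⟨fun x hx => ?_, fun β hβ x hβx hx => ?_, ?_⟩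
      · exact (h1 x hx).congr fun q hq => h q (Omega.mem_of_mem_of_le hq
          (Omega.succ_le_iff.2 (Omega.lt_succ_iff.2 hx)))
      · rw [← h x.1 (Omega.lt_succ_iff.2 hx)]
        exact h2 β hβ x hβx hx
      · rwa [← h _ (a μ).lt_succ])
    (by
      intro μ r l hr h
      obtain ⟨e₀, he₀, he₀'⟩ := Omega.exists_least_failure (fun x => Spread r x) ⊥ l
      choose e he he' using fun β : ν.ord.ToType => Omega.exists_least_failure
        (fun x => β ∈ J → app (app r x) (a β).1 ≠ zero V) (a β) l
      have hμν : #(Set.Iio μ) < ν := mk_Iio_toType_lt μ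
      have hlt : #(Option (Set.Iio μ)) < ν := by
        rw [Cardinal.mk_option]
        exact Cardinal.add_lt_of_lt hν hμν (Cardinal.one_lt_aleph0.trans_le hν)
      obtain ⟨c, hc1, hc2⟩ := hF _ hlt (Set.Iio μ) (Option (Set.Iio μ))
        (fun α => (a α.1).succ) (fun k => k.elim (min (min (a μ) l) e₀) fun β => e β.1)
        (by rw [Cardinal.mk_option]; exact self_le_add_right _ _) le_rfl ⟨none⟩ (by
          rintro ⟨α, hα⟩ (_ | ⟨β, hβ⟩)
          · refine le_min (le_min (Omega.succ_le_iff.2 (ha hα))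
              (Omega.succ_le_iff.2 (h α hα).1)) (Omega.succ_le_iff.2 (he₀' _ fun x _ hx => ?_))
            exact ⟨hx.trans_lt (h α hα).1, (h α hα).2.1 x hx⟩
          · refine Omega.succ_le_iff.2 (he' β _ fun x hβx hxα => ⟨hxα.trans_lt (h α hα).1, ?_⟩)
            exact (h α hα).2.2.1 β (ha.le_iff_le.1 (hβx.trans hxα)) x hβx hxα)
      have hcμ : c ≤ a μ := ((hc2 none).trans (min_le_left _ _)).trans (min_le_left _ _)
      have hcl : c ≤ l := ((hc2 none).trans (min_le_left _ _)).trans (min_le_right _ _)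
      have hce : c ≤ e₀ := (hc2 none).trans (min_le_right _ _)
      have hcN : c < N := hcμ.trans_lt (haN μ)
      -- On `[c, a μ]` the constant value `w` is to be used. The clauses ensure that it is spread
      -- for pairs with `q < c`, for pairs with `q = a μ`, and that no point of `[c, a μ)` is alive.
      obtain ⟨C₀, hC₀⟩ := exists_sep W (fun w =>
        (∀ p q, p ∊ q → q ∊ c.1 → app w p ≠ zero V → app w q ≠ zero V →
          ¬ app (app r q) p ∊ (a μ).1) ∧
        (∀ p, p ∊ N.1 → app w p ≠ zero V → ¬ app w p ∊ (a μ).1) ∧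
        (∀ q, q ∊ (a μ).1 → ¬ q ∊ c.1 → app w q = zero V))
      choose C hC using fun β : ν.ord.ToType => exists_sep W (fun w => app w (a β).1 = (b (γ μ β)).1)
      have hindex : #(Option {β : Set.Iic μ // β.1 ∈ J}) < ν := by
        rw [Cardinal.mk_option]
        exact Cardinal.add_lt_of_lt hν ((Cardinal.mk_subtype_le _).trans_lt (hIic μ))
          (Cardinal.one_lt_aleph0.trans_le hν)
      obtain ⟨w, hwW, hw⟩ := hT.exists_mem_forall hF ha haN hW hindex
        (fun k => k.elim C₀ fun β => C β.1.1) (by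
          intro t
          -- Finitely many requirements are met by a function supported on points `a β`: all
          -- recorded values belong to the upper side and thus exceed `a μ`.
          obtain ⟨w, hw, hw1, hw2⟩ := exists_func_of_finset ha.injective (v := fun β => b (γ μ β))
            (fun β => hbN _) hN0 (t.eraseNone.image fun β => β.1.1)
          have hT' : ∀ β ∈ t.eraseNone.image (fun β => β.1.1), β ≤ μ ∧ β ∈ J := by
            intro β hβ
            obtain ⟨β', -, rfl⟩ := Finset.mem_image.1 hβ
            exact ⟨β'.1.2, β'.2⟩
          refine ⟨w, (hW' w).2 hw, ?_⟩
          rintro (_ | β) hβ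
          · refine (hC₀ w).2 ⟨(hW' w).2 hw, fun p q hpq hq hp0 hq0 => ?_, fun p hp hp0 => ?_,
              fun q hq hqc => ?_⟩
            · have hqN : q ∊ N.1 := N.2.trans hcN hq
              obtain ⟨β', hβ', rfl, -⟩ := hw2 q hqN hq0
              obtain ⟨β, -, rfl, -⟩ := hw2 p (N.2.trans hqN hpq) hp0
              have h1 : β' < μ := ha.lt_iff_lt.1 (lt_of_lt_of_le (b := c) hq hcμ)
              rw [(h β' h1).2.2.2 (hT' β' hβ').2 β (ha.lt_iff_lt.1 hpq)]
              exact (hab μ _).not_gt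
            · obtain ⟨β, -, -, e⟩ := hw2 p hp hp0
              rw [e]
              exact (hab μ _).not_gt
            · by_contra hq0
              obtain ⟨β, -, rfl, -⟩ := hw2 q (N.2.trans (haN μ) hq) hq0
              exact hqc (Omega.succ_le_iff.1 (hc1 ⟨β, ha.lt_iff_lt.1 hq⟩))
          · exact (hC _ w).2 ⟨(hW' w).2 hw, hw1 _ (Finset.mem_image_of_mem _
              (Finset.mem_eraseNone.2 hβ)) (haN _)⟩)
      obtain ⟨-, hw1, hw2, hw3⟩ := (hC₀ w).1 (hw none)
      -- For `β = μ` the label is arbitrary; it only has to make `a μ` alive.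
      have hwβ : ∀ β ≤ μ, β ∈ J → app w (a β).1 = (b (γ μ β)).1 := fun β hβ hβJ =>
        ((hC β w).1 (hw (some ⟨⟨β, hβ⟩, hβJ⟩))).2
      obtain ⟨s, hs, hs'⟩ := exists_func (a μ).succ.1 W
        (fun x => if x ∊ c.1 then app r x else w) (by
          intro x _
          split_ifs with hx
          · exact hr.app_mem (Omega.mem_of_mem_of_le hx hcl)
          · exact hwW)
      have hsc : ∀ x, x ∊ c.1 → app s x = app r x := fun x hx =>
        (hs' x (Omega.mem_of_mem_of_le hx (hcμ.trans (Omega.lt_succ _).le))).trans (if_pos hx)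
      have hsw : ∀ x : Omega V, c ≤ x → x ≤ a μ → app s x.1 = w := fun x hcx hx =>
        (hs' x.1 (Omega.lt_succ_iff.2 hx)).trans (if_neg hcx.not_gt)
      refine ⟨s, hs, fun α hα x hx => hsc x (Omega.mem_of_mem_of_le hx (hc1 ⟨α, hα⟩)),
        fun x hx => ?_, fun β hβ x hβx hx hβJ => ?_, fun hμJ β hβ => ?_⟩
      · by_cases hxc : x < c
        · refine Spread.congr (fun q hq => (hsc q ?_).symm)
            (he₀ x bot_le (hxc.trans_le hce)).2
          exact Omega.mem_of_mem_of_le hq (Omega.succ_le_iff.2 hxc)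
        · intro p q hq hpq hp0 hq0
          rw [hsw x (not_lt.1 hxc) hx] at hp0 hq0
          have hqx : x.succ.ofMem hq ≤ x := Omega.lt_succ_iff.1 hq
          have hnot : ∀ y, ¬ y ∊ (a μ).1 → ¬ y ∊ x.1 := fun y hy hyx =>
            hy (Omega.mem_of_mem_of_le hyx hx)
          apply hnot
          by_cases hqc : q ∊ c.1
          · rw [hsc q hqc]
            exact hw1 p q hpq hqc hp0 hq0
          · have hqμ : ¬ q ∊ (a μ).1 := fun hqμ => hq0 (hw3 q hqμ hqc)
            have hsq : app s q = w := hsw (x.succ.ofMem hq) (not_lt.1 hqc) (hqx.trans hx)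
            rw [hsq]
            exact hw2 p (N.2.trans (lt_of_le_of_lt (a := x.succ.ofMem hq)
              (hqx.trans hx) (haN μ)) hpq) hp0
      · by_cases hxc : x < c
        · rw [hsc x.1 hxc]
          rcases hβ.eq_or_lt with rfl | hβ
          · exact ((hxc.trans_le hcμ).not_ge hβx).elim
          · exact (he β x hβx (hxc.trans_le (hc2 (some ⟨β, hβ⟩)))).2 hβJ
        · rw [hsw x (not_lt.1 hxc) hx, hwβ β hβ hβJ]
          exact hb0 _
      · rw [hsw (a μ) hcμ le_rfl]
        exact hwβ β hβ.le (hJlower β μ hβ hμJ))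
  obtain ⟨e₀, he₀, he₀'⟩ := Omega.exists_least_failure (fun x => Spread r x) ⊥ l
  choose e he he' using fun β : ν.ord.ToType => Omega.exists_least_failure
    (fun x => β ∈ J → app (app r x) (a β).1 ≠ zero V) (a β) l
  -- As the cut is unfilled, whatever lies above all `a α` lies above some `b j`; this applies to
  -- every first failure.
  have hbelow : ∀ c, (∀ α, a α < c) → ∃ j, b j < c := by
    intro c hc
    by_contra h
    push Not at h
    exact hno ⟨c, fun α => (hc α).le, h⟩
  obtain ⟨k₀, hk₀⟩ := hbelow e₀ fun α => he₀' _ fun x _ hx =>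
    ⟨hx.trans_lt (hrl α).1, (hrl α).2.1 x hx⟩
  choose k hk using fun β : ν.ord.ToType => hbelow (e β) fun α => he' β _ fun x hβx hxα =>
    ⟨hxα.trans_lt (hrl α).1,
      (hrl α).2.2.1 β (ha.le_iff_le.1 (hβx.trans hxα)) x hβx hxα⟩
  -- One `b δ` lies below the first failures for more than `κ` indices, so at `b δ` all these `a β`
  -- are alive and `r` is spread.
  obtain ⟨δ, hδ⟩ := Cardinal.infinite_pigeonhole_card_lt (fun β : J => max k₀ (k β.1))
    (by rwa [Cardinal.mk_ord_toType]) (hκ.trans hJκ.le)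
  rw [Cardinal.mk_ord_toType] at hδ
  set B := (fun β : J => max k₀ (k β.1)) ⁻¹' {δ} with hB
  have hBδ : ∀ β ∈ B, b δ < e₀ ∧ b δ < e β.1 := by
    intro β hβ
    have hβ' : max k₀ (k β.1) = δ := hβ
    exact ⟨(hb.antitone (hβ' ▸ le_max_left _ _)).trans_lt hk₀,
      (hb.antitone (hβ' ▸ le_max_right _ _)).trans_lt (hk _)⟩
  have hle : ∀ β β' : B, β < β' → b δ ≤ b (γ β'.1.1 β.1.1) := by
    intro β β' hlt
    obtain ⟨h1, h2⟩ := hBδ β.1 β.2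
    obtain ⟨-, h3⟩ := hBδ β'.1 β'.2
    have h4 := (he β.1.1 (b δ) (hab _ _).le h2).2 β.1.2
    have h5 := (he β'.1.1 (b δ) (hab _ _).le h3).2 β'.1.2
    have h6 := (he₀ (b δ) bot_le h1).2 (a β.1.1).1 (a β'.1.1).1
      (Omega.lt_succ_iff.2 (hab _ _).le) (ha hlt) h4 h5
    rw [(hrl β'.1.1).2.2.2 β'.1.2 β.1.1 hlt] at h6
    exact not_lt.1 h6
  -- By `hle` the labels of predecessors within `B` are at most `δ`. The labels are injective, so
  -- each member of `B` has fewer than `κ` predecessors in `B`, whence `B` has size at most `κ`.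
  refine hδ.not_ge (mk_le_of_forall_mk_Iio_lt fun β' : B => ?_)
  have hinj : Function.Injective (fun β : Set.Iio β' =>
      (⟨γ β'.1.1 β.1.1.1, hb.le_iff_ge.1 (hle β.1 β' β.2)⟩ : Set.Iic δ)) := fun β β₁ h =>
    Subtype.ext (Subtype.ext (Subtype.ext
      (hγ _ β'.1.2 β.2 β₁.2 (congrArg Subtype.val h))))
  refine (Cardinal.mk_le_of_injective hinj).trans_lt ?_
  have hκ' : #κ.ord.ToType = κ := Cardinal.mk_ord_toType κ
  have : NoMaxOrder κ.ord.ToType := Cardinal.noMaxOrder hκ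
  exact (mk_Iic_lt (fun i => (mk_Iio_toType_lt i).trans_eq hκ'.symm) δ).trans_eq hκ'

end Asymmetric

end ZFCMinus

/-! ### Unbounded sequences in nonstandard models -/

namespace ZFCMinus

section Unbounded

variable {V : Type u} [setLang.Structure V] [hV : Fact (ModelsZFCMinus V)]

/-- The numbers with finitely many predecessors are closed under successor, and the others, which
exist by nonstandardness, are closed under predecessor; so nothing lies between the two sets. -/
theorem OmegaNonstandard.exists_not_fills (hω : OmegaNonstandard V) : ∃ ν, ¬ Fills V ν := by
  refine ⟨#(Omega V), fun hF => ?_⟩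
  let S : Set (Omega V) := {m | (Set.Iio m).Finite}
  have hsucc : ∀ m : Omega V, Set.Iio m.succ = insert m (Set.Iio m) := fun m => by
    ext x
    simp only [Set.mem_Iio, Set.mem_insert_iff, Omega.lt_succ_iff, le_iff_eq_or_lt]
  have hS : ∀ m : Omega V, m ∈ S → m.succ ∈ S := fun m hm => by
    change (Set.Iio m.succ).Finite
    rw [hsucc]
    exact Set.Finite.insert m hm
  obtain ⟨n, hn⟩ := hω
  obtain ⟨c, hc1, hc2⟩ := hF S (Sᶜ : Set (Omega V)) Subtype.val Subtype.val
    (Cardinal.mk_subtype_le _) (Cardinal.mk_subtype_le _) ⟨⟨n, hn⟩⟩ (by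
      rintro ⟨m, hm⟩ ⟨k, hk⟩
      by_contra h
      exact hk (Set.Finite.subset hm (Set.Iio_subset_Iio (not_le.1 h).le)))
  by_cases hc : c ∈ S
  · exact (hc1 ⟨_, hS c hc⟩).not_gt c.lt_succ
  · rcases c.eq_bot_or_succ with rfl | ⟨d, rfl⟩
    · exact hc (by simp [S])
    · exact (hc2 ⟨d, fun hd => hc (hS d hd)⟩).not_gt d.lt_succ

/-- In an `ω`-nonstandard model, some tree `n^{<n}` has an unbounded increasing sequence. -/
theorem OmegaNonstandard.not_treesBounded (hω : OmegaNonstandard V) : ¬ TreesBounded V := by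
  intro hT
  obtain ⟨ν, hν, hmin⟩ := wellFounded_lt.has_min {ν : Cardinal.{u} | ¬ Fills V ν}
    hω.exists_not_fills
  have hF : ∀ μ < ν, Fills V μ := fun μ hμ => not_not.1 fun h => hmin μ h hμ
  have hν' : ¬ Fills V ν := hν
  unfold Fills at hν'
  push Not at hν'
  obtain ⟨J, K, a, b, hJ, hK, hKne, hab, hno⟩ := hν'
  have hJne : Nonempty (Set.range a) := by
    by_contra h
    obtain ⟨k, hk⟩ := hno ⊥ fun j => (h ⟨⟨_, j, rfl⟩⟩).elim
    exact not_lt_bot hk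
  have hKne' : Nonempty (Set.range b)ᵒᵈ := (Set.range_nonempty b).to_subtype
  -- A greatest element of the lower side would fill the gap; likewise for a least element of the
  -- upper side.
  have hJmax : NoMaxOrder (Set.range a) := by
    refine ⟨?_⟩
    rintro ⟨_, j, rfl⟩
    by_contra h
    push Not at h
    obtain ⟨k, hk⟩ := hno (a j) fun i => h ⟨_, i, rfl⟩
    exact hk.not_ge (hab j k)
  have hKmax : NoMaxOrder (Set.range b)ᵒᵈ := by
    refine ⟨?_⟩
    rintro ⟨_, k, rfl⟩
    by_contra h
    push Not at h
    obtain ⟨k', hk'⟩ := hno (b k) fun i => hab i k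
    exact hk'.not_ge (not_lt.1 (h (OrderDual.toDual ⟨_, k', rfl⟩)) :)
  obtain ⟨κ, hκ, hκJ, f, hf, hfcof⟩ := exists_strictMono_cofinal (Set.range a)
  obtain ⟨θ, hθ, hθK, g, hg, hgcof⟩ := exists_strictMono_cofinal (Set.range b)ᵒᵈ
  have hκν : κ ≤ ν := hκJ.trans (Cardinal.mk_range_le.trans hJ)
  have hθν : θ ≤ ν := hθK.trans (Cardinal.mk_range_le.trans hK)
  let A : κ.ord.ToType → Omega V := fun i => (f i).1
  let B : θ.ord.ToType → Omega V := fun i => (OrderDual.ofDual (g i)).1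
  have hA : StrictMono A := hf
  have hB : StrictAnti B := hg
  have hκne : Nonempty κ.ord.ToType := Cardinal.nonempty_ord_toType hκ.ne_zero
  have hθne : Nonempty θ.ord.ToType := Cardinal.nonempty_ord_toType hθ.ne_zero
  have hκmax : NoMaxOrder κ.ord.ToType := Cardinal.noMaxOrder hκ.aleph0_le
  have hθmax : NoMaxOrder θ.ord.ToType := Cardinal.noMaxOrder hθ.aleph0_le
  have hle : ∀ i j, A i ≤ B j := by
    intro i j
    obtain ⟨i', hi'⟩ := (f i).2
    obtain ⟨j', hj'⟩ := (OrderDual.ofDual (g j)).2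
    change (f i).1 ≤ (OrderDual.ofDual (g j)).1
    rw [← hi', ← hj']
    exact hab i' j'
  have hlt : ∀ i j, A i < B j := fun i j => by
    obtain ⟨i', hi'⟩ := exists_gt i
    exact (hA hi').trans_le (hle i' j)
  have hno' : ¬ ∃ c, (∀ i, A i ≤ c) ∧ ∀ j, c ≤ B j := by
    rintro ⟨c, hc1, hc2⟩
    obtain ⟨k, hk⟩ := hno c fun j => by
      obtain ⟨i, hi⟩ := hfcof ⟨_, j, rfl⟩
      exact le_trans hi (hc1 i)
    obtain ⟨j, hj⟩ := hgcof (OrderDual.toDual ⟨_, k, rfl⟩)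
    exact hk.not_ge ((hc2 j).trans hj)
  obtain ⟨N, hN⟩ : ∃ N : Omega V, ∀ j, B j < N := by
    obtain ⟨j, -, hj⟩ := wellFounded_lt.has_min (Set.univ : Set θ.ord.ToType) Set.univ_nonempty
    exact ⟨(B j).succ, fun i => Omega.lt_succ_iff.2 (hB.antitone (not_lt.1 (hj i trivial)))⟩
  -- Two sides shorter than `ν` are filled by minimality, so at least one of them has length `ν`.
  rcases hκν.eq_or_lt with rfl | hκν
  · rcases hθν.eq_or_lt with rfl | hθν
    · exact hno' (hT.exists_between_of_antitone hA hB.antitone hN hlt)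
    · exact hno' (hT.exists_between_of_lt hθ.aleph0_le hθν hF hA hB hlt)
  rcases hθν.eq_or_lt with rfl | hθν
  swap
  · exact hno' (hF _ (max_lt hκν hθν) _ _ A B
      (by rw [Cardinal.mk_ord_toType]; exact le_max_left _ _)
      (by rw [Cardinal.mk_ord_toType]; exact le_max_right _ _) hθne hle)
  -- The upper side is the longer one. Reversing the order on the predecessors of `N` exchanges the
  -- sides, and rounding brings a filling number back to a predecessor of `N`.
  obtain ⟨e, he, hround⟩ := N.2.vFinite.exists_rounded_embedding (fun x y => y ∊ x)
    (fun x _ => notMem_self x) (fun x y z hx _ _ hxy hyz => (N.2.mem hx).trans hxy hyz)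
    (fun x y hx hy => by
      rcases (N.2.mem hx).trichotomy (N.2.mem hy) with h | h | h
      exacts [.inr (.inl h), .inl h.symm, .inr (.inr h)])
  have hBN : ∀ j, (B j).1 ∊ N.1 := hN
  have hAN : ∀ i, (A i).1 ∊ N.1 := fun i => (hlt i hθne.some).trans (hN _)
  have heB : StrictMono fun j => e (B j).1 := fun j j' h => he _ _ (hBN j) (hBN j') (hB h)
  have heA : StrictAnti fun i => e (A i).1 := fun i i' h => he _ _ (hAN i') (hAN i) (hA h)
  obtain ⟨c, hc1, hc2⟩ := hT.exists_between_of_lt hκ.aleph0_le hκν hF heB heA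
    fun j i => he _ _ (hBN j) (hAN i) (hlt i j)
  obtain ⟨x, hx, hx1, hx2⟩ := hround c ⟨_, hBN hθne.some, hc1 _⟩
  refine hno' ⟨N.ofMem hx, fun i => ?_, fun j => ?_⟩
  · obtain ⟨i', hi'⟩ := exists_gt i
    exact le_of_lt (hx2 _ (hAN i) ((hc2 i').trans_lt (heA hi')))
  · rcases hx1 _ (hBN j) (hc1 j) with h | h
    · exact le_of_eq (Subtype.ext h.symm)
    · exact le_of_lt h

end Unbounded

end ZFCMinus

theorem mainTheorem4 {V : Type u} [ZFCMinus.setLang.Structure V]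
    (hV : ZFCMinus.ModelsZFCMinus V) (hω : ZFCMinus.OmegaNonstandard V) :
    ZFCMinus.pNumber V ≤ ZFCMinus.tNumber V ∧
      (ZFCMinus.tNumber V, ZFCMinus.tNumber V) ∈ ZFCMinus.cutSpectrumOmega V := by
  have : Fact (ZFCMinus.ModelsZFCMinus V) := ⟨hV⟩
  have hT := hω.not_treesBounded
  unfold ZFCMinus.TreesBounded at hT
  push Not at hT
  obtain ⟨n, hn, κ, s, hs, hub⟩ := hT
  have hne : (ZFCMinus.unboundedLengths (ZFCMinus.SeqTree n)).Nonempty := ⟨κ, s, hs, hub⟩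
  -- The infimum is over a nonempty set of cardinals, so it is attained and is not the default value
  -- `0`.
  have hmem : ZFCMinus.tNumber V ∈ {κ | ∃ n : ZFCMinus.Omega V, (∃ m : ZFCMinus.Omega V, m < n) ∧
      ZFCMinus.IsTreeTops (ZFCMinus.SeqTree n) κ} :=
    csInf_mem ⟨_, n, hn, csInf_mem hne, fun _ h => csInf_le' h⟩
  obtain ⟨m, hm, htop⟩ := hmem
  have hcut := ZFCMinus.mem_cutSpectrumOmega_of_isTreeTops hm htop
  refine ⟨csInf_le' ⟨_, _, hcut, ?_⟩, hcut⟩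
  exact (Cardinal.add_eq_self hcut.1.aleph0_le).symm
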